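/- Let $\mathbb O$ be the octonions with basis $1,e_1,\dots,e_7$, where $e_i^2=-1$, $e_je_i=-e_ie_j$ for $i\neq j$, and $e_1e_2=-e_5$, $e_1e_3=-e_6$, $e_1e_4=-e_7$, $e_2e_3=-e_7$, $e_2e_4=e_6$, $e_3e_4=-e_5$, $e_5e_6=e_7$, the other products being determined by the rule that $e_ie_j=\pm e_k$ implies $e_je_k=\pm e_i$ with the same sign. Let $\mathbb O_{\mathbb C}=\mathbb O\otimes\mathbb C$ and $\mathbb C^7=\operatorname{Im}(\mathbb O)\otimes\mathbb C$. For $x,y\in\mathbb C^7$ let $x\cdot y\in\mathbb C^7$ be the octonionic-imaginary part of the product $xy$, and let $\langle x,y\rangle=\sum_i x_iy_i$. Let $\mathbb G_2\subset \mathrm{SO}(7,\mathbb C)$ be the automorphism group of $\mathbb O_{\mathbb C}$, acting on $\mathbb C^7$, with the antiholomorphic involution $\tau(A)=\overline A$, whose fixed point group is the compact group $\mathrm G_2$. Let $\mathcal L_-^\tau(\mathbb G_2,\mathbb C^7)$ be the group, under pointwise multiplication, of holomorphic maps $g:U\to\mathbb G_2$, with $U\subset\mathbb{CP}^1$ open and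 dense and with two maps identified if they agree on an open dense set, such that - (rational) $g$, as a map to $\operatorname{End}(\mathbb C^7)$, is meromorphic on $\mathbb{CP}^1$; - (negative) $g$ is holomorphic at $\infty$ and $g(\infty)=\mathrm{Id}$; - (real) $\tau(g(\bar\lambda))=g(\lambda)$. A complex coassociative plane is a two-dimensional complex subspace $\mathcal C\subset\mathbb C^7$ with $\langle x,y\rangle=0$ and $x\cdot y=0$ for all $x,y\in\mathcal C$. Put $\mathcal A=(\mathcal C\oplus\overline{\mathcal C})^\perp$. Then $\mathbb C^7=\mathcal C\oplus\mathcal A\oplus\overline{\mathcal C}$ is a hermitian orthogonal decomposition, with orthogonal projections $\pi_{\mathcal C},\pi_{\mathcal A},\pi_{\overline{\mathcal C}}$. For $\alpha\in\mathbb C\setminus\mathbb R$ let $$p_{\alpha,\mathcal C}(\lambda)=\frac{\lambda-\bar\alpha}{\lambda-\alpha}\,\pi_{\overline{\mathcal C}}+\pi_{\mathcal A}+\frac{\lambda-\alpha}{\lambda-\bar\alpha}\,\pi_{\mathcal C}.$$ **Theorem.** The simple elements $p_{\alpha,\mathcal C}$, where $\alpha\in\mathbb C\setminus\mathbb R$ and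 $\mathcal C\subset\mathbb C^7$ is a complex coassociative plane, belong to the group $\mathcal L_-^\tau(\mathbb G_2,\mathbb C^7)$ and generate it. -/

import Mathlib

open Filter
open scoped OnePoint Matrix

/-! ### The complexified octonions and the complex group `G₂` -/

/-- The octonionic-imaginary part `x · y` of the product of two imaginary octonions, extended
complex bilinearly to `ℂ⁷ = Im 𝕆 ⊗ ℂ`.  In the basis `e₁, …, e₇` (coordinates `0, …, 6`):
`e₁e₂ = -e₅`, `e₁e₃ = -e₆`, `e₁e₄ = -e₇`, `e₁e₅ = e₂`, `e₁e₆ = e₃`, `e₁e₇ = e₄`,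
`e₂e₃ = -e₇`, `e₂e₄ = e₆`, `e₂e₅ = -e₁`, `e₂e₆ = -e₄`, `e₂e₇ = e₃`,
`e₃e₄ = -e₅`, `e₃e₅ = e₄`, `e₃e₆ = -e₁`, `e₃e₇ = -e₂`,
`e₄e₅ = -e₃`, `e₄e₆ = e₂`, `e₄e₇ = -e₁`, `e₅e₆ = e₇`, `e₅e₇ = -e₆`, `e₆e₇ = e₅`,
and `eⱼeᵢ = -eᵢeⱼ` for `i ≠ j`. -/
def imMul (x y : Fin 7 → ℂ) : Fin 7 → ℂ :=
  ![(x 4 * y 1 - x 1 * y 4) + (x 5 * y 2 - x 2 * y 5) + (x 6 * y 3 - x 3 * y 6),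
    (x 0 * y 4 - x 4 * y 0) + (x 6 * y 2 - x 2 * y 6) + (x 3 * y 5 - x 5 * y 3),
    (x 0 * y 5 - x 5 * y 0) + (x 1 * y 6 - x 6 * y 1) + (x 4 * y 3 - x 3 * y 4),
    (x 0 * y 6 - x 6 * y 0) + (x 5 * y 1 - x 1 * y 5) + (x 2 * y 4 - x 4 * y 2),
    (x 1 * y 0 - x 0 * y 1) + (x 3 * y 2 - x 2 * y 3) + (x 5 * y 6 - x 6 * y 5),
    (x 2 * y 0 - x 0 * y 2) + (x 1 * y 3 - x 3 * y 1) + (x 6 * y 4 - x 4 * y 6),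
    (x 3 * y 0 - x 0 * y 3) + (x 2 * y 1 - x 1 * y 2) + (x 4 * y 5 - x 5 * y 4)]

/-- The product of `𝕆 ⊗ ℂ = ℂ · 1 ⊕ ℂ⁷`.  On basis vectors it is given by the table of `imMul`
together with `eᵢeᵢ = -1` and `1` being the unit. -/
def octMul (p q : ℂ × (Fin 7 → ℂ)) : ℂ × (Fin 7 → ℂ) :=
  (p.1 * q.1 - p.2 ⬝ᵥ q.2, p.1 • q.2 + q.1 • p.2 + imMul p.2 q.2)

/-- The linear map `id ⊕ A` of `𝕆 ⊗ ℂ = ℂ · 1 ⊕ ℂ⁷`. -/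
def octExtend (A : Matrix (Fin 7) (Fin 7) ℂ) (p : ℂ × (Fin 7 → ℂ)) : ℂ × (Fin 7 → ℂ) :=
  (p.1, A *ᵥ p.2)

/-- The complex group `G₂`, the automorphism group of `𝕆 ⊗ ℂ`, in its representation on
`ℂ⁷ = Im 𝕆 ⊗ ℂ`.  (An automorphism fixes `1`, and it preserves `ℂ⁷`, whose nonzero elements are
those `x ∉ ℂ · 1` with `x² ∈ ℂ · 1`; so it is of the form `id ⊕ A`.) -/
def complexG2 : Subgroup (GL (Fin 7) ℂ) where
  carrier := {A | ∀ p q, octExtend A (octMul p q) = octMul (octExtend A p) (octExtend A q)}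
  one_mem' := by
    intro p q
    simp [octExtend]
  mul_mem' := by
    intro A B hA hB p q
    have h : ∀ r, octExtend ((A * B : GL (Fin 7) ℂ) : Matrix (Fin 7) (Fin 7) ℂ) r
        = octExtend A (octExtend B r) := by
      intro r; simp [octExtend]
    simp only [Set.mem_ofPred_eq] at hA hB
    rw [h, h, h, hB, hA]
  inv_mem' := by
    intro A hA p q
    have h1 : ∀ r, octExtend A
        (octExtend ((A⁻¹ : GL (Fin 7) ℂ) : Matrix (Fin 7) (Fin 7) ℂ) r) = r := by
      intro r
      simp only [octExtend, Matrix.mulVec_mulVec, ← Units.val_mul, mul_inv_cancel, Units.val_one,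
        Matrix.one_mulVec]
    have h2 : ∀ r, octExtend ((A⁻¹ : GL (Fin 7) ℂ) : Matrix (Fin 7) (Fin 7) ℂ)
        (octExtend A r) = r := by
      intro r
      simp only [octExtend, Matrix.mulVec_mulVec, ← Units.val_mul, inv_mul_cancel, Units.val_one,
        Matrix.one_mulVec]
    simp only [Set.mem_ofPred_eq] at hA
    conv_lhs => rw [← h1 p, ← h1 q, ← hA, h2]

/-! ### Holomorphic and meromorphic maps on `ℂP¹ = OnePoint ℂ` -/

/-- The filter of all subsets of `X` that contain an open dense set. -/
def denseOpen (X : Type*) [TopologicalSpace X] : Filter X where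
  sets := {s | ∃ U : Set X, IsOpen U ∧ Dense U ∧ U ⊆ s}
  univ_sets := ⟨Set.univ, isOpen_univ, dense_univ, subset_rfl⟩
  sets_of_superset := by
    rintro s t ⟨U, hU, hd, hs⟩ hst
    exact ⟨U, hU, hd, hs.trans hst⟩
  inter_sets := by
    rintro s t ⟨U, hU, hUd, hs⟩ ⟨W, hW, hWd, ht⟩
    exact ⟨U ∩ W, hU.inter hW, hUd.inter_of_isOpen_left hWd hU, Set.inter_subset_inter hs ht⟩

open Classical in
/-- The inverse of the standard holomorphic chart of `ℂP¹` at a point: the inclusion of `ℂ` at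
finite points, and `w ↦ 1 / w` (with `0 ↦ ∞`) at `∞`. -/
noncomputable def cpCoord : OnePoint ℂ → ℂ → OnePoint ℂ
  | ∞ => fun w => if w = 0 then ∞ else ((w⁻¹ : ℂ) : OnePoint ℂ)
  | (_ : ℂ) => fun w => (w : OnePoint ℂ)

/-- The coordinate of a point of `ℂP¹` in the standard chart at that point. -/
def cpCenter : OnePoint ℂ → ℂ
  | ∞ => 0
  | (z : ℂ) => z

/-- A matrix-valued map on `ℂP¹` is holomorphic (in a neighbourhood of, and) at the point `p`. -/
def HolomorphicAtPt {n : ℕ} (M : OnePoint ℂ → Matrix (Fin n) (Fin n) ℂ) (p : OnePoint ℂ) : Prop :=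
  ∀ i j, AnalyticAt ℂ (fun w => M (cpCoord p w) i j) (cpCenter p)

/-- A matrix-valued map on `ℂP¹` is meromorphic at the point `p`. -/
def MeromorphicAtPt {n : ℕ} (M : OnePoint ℂ → Matrix (Fin n) (Fin n) ℂ) (p : OnePoint ℂ) : Prop :=
  ∀ i j, MeromorphicAt (fun w => M (cpCoord p w) i j) (cpCenter p)

/-! ### Loop groups -/

/-- Maps from open dense subsets of `ℂP¹` to `GL(n, ℂ)`, where maps that agree on an open dense set
are identified. -/
abbrev LoopGerm (n : ℕ) : Type := Germ (denseOpen (OnePoint ℂ)) (GL (Fin n) ℂ)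

theorem HolomorphicAtPt.mul {n : ℕ} {M N : OnePoint ℂ → Matrix (Fin n) (Fin n) ℂ} {p : OnePoint ℂ}
    (hM : HolomorphicAtPt M p) (hN : HolomorphicAtPt N p) :
    HolomorphicAtPt (fun q => M q * N q) p := by
  intro i j
  simp only [Matrix.mul_apply]
  exact Finset.analyticAt_fun_sum _ fun k _ => (hM i k).mul (hN k j)

theorem MeromorphicAtPt.mul {n : ℕ} {M N : OnePoint ℂ → Matrix (Fin n) (Fin n) ℂ} {p : OnePoint ℂ}
    (hM : MeromorphicAtPt M p) (hN : MeromorphicAtPt N p) :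
    MeromorphicAtPt (fun q => M q * N q) p := by
  intro i j
  simp only [Matrix.mul_apply]
  exact MeromorphicAt.fun_sum fun k _ => (hM i k).mul (hN k j)

theorem HolomorphicAtPt.one {n : ℕ} {p : OnePoint ℂ} :
    HolomorphicAtPt (fun _ => (1 : Matrix (Fin n) (Fin n) ℂ)) p :=
  fun _ _ => analyticAt_const

theorem HolomorphicAtPt.inv {n : ℕ} {f : OnePoint ℂ → GL (Fin n) ℂ} {p : OnePoint ℂ}
    (hf : HolomorphicAtPt (fun q => (f q : Matrix (Fin n) (Fin n) ℂ)) p) :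
    HolomorphicAtPt (fun q => (((f q)⁻¹ : GL (Fin n) ℂ) : Matrix (Fin n) (Fin n) ℂ)) p := by
  intro i j
  have hdet : ∀ N : ℂ → Matrix (Fin n) (Fin n) ℂ,
      (∀ i j, AnalyticAt ℂ (fun w => N w i j) (cpCenter p)) →
      AnalyticAt ℂ (fun w => (N w).det) (cpCenter p) := by
    intro N hN
    simp only [Matrix.det_apply']
    exact Finset.analyticAt_fun_sum _ fun σ _ => analyticAt_const.mul
      (Finset.analyticAt_fun_prod _ fun k _ => hN _ _)
  simp only [Matrix.coe_units_inv, Matrix.inv_def, Ring.inverse_eq_inv', Matrix.smul_apply,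
    smul_eq_mul, Matrix.adjugate_apply]
  refine ((hdet _ hf).inv ((f _).isUnit.map Matrix.detMonoidHom).ne_zero).mul (hdet _ ?_)
  intro a b
  by_cases h : a = j
  · subst h
    simpa using analyticAt_const
  · simpa [Matrix.updateRow_apply, h] using hf a b

theorem MeromorphicAtPt.inv {n : ℕ} {M : OnePoint ℂ → Matrix (Fin n) (Fin n) ℂ} {p : OnePoint ℂ}
    (hM : MeromorphicAtPt M p) : MeromorphicAtPt (fun q => (M q)⁻¹) p := by
  intro i j
  have hdet : ∀ N : ℂ → Matrix (Fin n) (Fin n) ℂ,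
      (∀ i j, MeromorphicAt (fun w => N w i j) (cpCenter p)) →
      MeromorphicAt (fun w => (N w).det) (cpCenter p) := by
    intro N hN
    simp only [Matrix.det_apply']
    exact MeromorphicAt.fun_sum fun σ _ => (MeromorphicAt.const _ _).mul
      (MeromorphicAt.fun_prod fun k _ => hN _ _)
  simp only [Matrix.inv_def, Ring.inverse_eq_inv', Matrix.smul_apply,
    smul_eq_mul, Matrix.adjugate_apply]
  refine (hdet _ hM).inv.mul (hdet _ ?_)
  intro a b
  by_cases h : a = j
  · subst h
    simp
  · simpa [Matrix.updateRow_apply, h] using hM a b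

/-- The holomorphic loop group of `G ⊆ GL(n, ℂ)`: holomorphic maps `U → G` with `U ⊆ ℂP¹` open and
dense. -/
def holomorphicLoops {n : ℕ} (G : Subgroup (GL (Fin n) ℂ)) : Subgroup (LoopGerm n) where
  carrier := {γ | ∃ f : OnePoint ℂ → GL (Fin n) ℂ, γ = ↑f ∧
    ∃ U : Set (OnePoint ℂ), IsOpen U ∧ Dense U ∧
      ∀ p ∈ U, f p ∈ G ∧ HolomorphicAtPt (fun q => (f q : Matrix (Fin n) (Fin n) ℂ)) p}
  one_mem' := ⟨1, rfl, Set.univ, isOpen_univ, dense_univ,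
    fun _ _ => ⟨G.one_mem, HolomorphicAtPt.one⟩⟩
  mul_mem' := by
    rintro _ _ ⟨f, rfl, U, hU, hUd, hf⟩ ⟨g, rfl, W, hW, hWd, hg⟩
    exact ⟨f * g, rfl, U ∩ W, hU.inter hW, hUd.inter_of_isOpen_left hWd hU, fun p hp =>
      ⟨G.mul_mem (hf p hp.1).1 (hg p hp.2).1, (hf p hp.1).2.mul (hg p hp.2).2⟩⟩
  inv_mem' := by
    rintro _ ⟨f, rfl, U, hU, hUd, hf⟩
    exact ⟨f⁻¹, rfl, U, hU, hUd, fun p hp => ⟨G.inv_mem (hf p hp).1, HolomorphicAtPt.inv (hf p hp).2⟩⟩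

/-- Loops that agree on an open dense set with a matrix-valued map that is meromorphic on all of
`ℂP¹`. -/
def rationalLoops (n : ℕ) : Subgroup (LoopGerm n) where
  carrier := {γ | ∃ M : OnePoint ℂ → Matrix (Fin n) (Fin n) ℂ,
    γ.map (fun A : GL (Fin n) ℂ => (A : Matrix (Fin n) (Fin n) ℂ)) = ↑M ∧
      ∀ p, MeromorphicAtPt M p}
  one_mem' := ⟨fun _ => 1, rfl, fun _ _ _ => MeromorphicAt.const _ _⟩
  mul_mem' := by
    intro γ δ
    induction γ using Germ.inductionOn with | _ f
    induction δ using Germ.inductionOn with | _ g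
    rintro ⟨M, hM, hM'⟩ ⟨N, hN, hN'⟩
    refine ⟨fun q => M q * N q, ?_, fun p => (hM' p).mul (hN' p)⟩
    rw [Germ.map_coe, Germ.coe_eq] at hM hN
    rw [← Germ.coe_mul, Germ.map_coe, Germ.coe_eq]
    filter_upwards [hM, hN] with q h1 h2
    simp only [Function.comp_apply] at h1 h2
    simp [h1, h2]
  inv_mem' := by
    intro γ
    induction γ using Germ.inductionOn with | _ f
    rintro ⟨M, hM, hM'⟩
    refine ⟨fun q => (M q)⁻¹, ?_, fun p => (hM' p).inv⟩
    rw [Germ.map_coe, Germ.coe_eq] at hM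
    rw [← Germ.coe_inv, Germ.map_coe, Germ.coe_eq]
    filter_upwards [hM] with q h1
    simp only [Function.comp_apply] at h1
    simp [← h1]

/-- Negative loops: holomorphic at `∞`, with value the identity there. -/
def negativeLoops (n : ℕ) : Subgroup (LoopGerm n) where
  carrier := {γ | ∃ f : OnePoint ℂ → GL (Fin n) ℂ, γ = ↑f ∧
    HolomorphicAtPt (fun q => (f q : Matrix (Fin n) (Fin n) ℂ)) ∞ ∧ f ∞ = 1}
  one_mem' := ⟨1, rfl, HolomorphicAtPt.one, rfl⟩
  mul_mem' := by
    rintro _ _ ⟨f, rfl, hf, hf1⟩ ⟨g, rfl, hg, hg1⟩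
    exact ⟨f * g, rfl, hf.mul hg, by simp [hf1, hg1]⟩
  inv_mem' := by
    rintro _ ⟨f, rfl, hf, hf1⟩
    exact ⟨f⁻¹, rfl, HolomorphicAtPt.inv hf, by simp [hf1]⟩

/-- The antiholomorphic involution `τ(A) = conj A` (entrywise) of `GL(n, ℂ)`.  It restricts to the
complex group `G₂`, where its fixed point group is the compact real form. -/
noncomputable def conjGL (n : ℕ) : GL (Fin n) ℂ →* GL (Fin n) ℂ :=
  Matrix.GeneralLinearGroup.map (starRingEnd ℂ)

/-- Loops that satisfy the reality condition `τ(g(conj λ)) = g(λ)`. -/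
noncomputable def realLoops (n : ℕ) : Subgroup (LoopGerm n) where
  carrier := {γ | ∃ f : OnePoint ℂ → GL (Fin n) ℂ, γ = ↑f ∧
    ∀ᶠ p in denseOpen (OnePoint ℂ), conjGL n (f (OnePoint.map (starRingEnd ℂ) p)) = f p}
  one_mem' := ⟨1, rfl, Eventually.of_forall fun _ => by simp⟩
  mul_mem' := by
    rintro _ _ ⟨f, rfl, hf⟩ ⟨g, rfl, hg⟩
    refine ⟨f * g, rfl, ?_⟩
    filter_upwards [hf, hg] with p h1 h2
    simp [h1, h2]
  inv_mem' := by
    rintro _ ⟨f, rfl, hf⟩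
    refine ⟨f⁻¹, rfl, ?_⟩
    filter_upwards [hf] with p h1
    simp [h1]

/-- The negative rational real loop group `ℒ₋^τ(G, ℂⁿ)` of `G ⊆ GL(n, ℂ)`. -/
noncomputable def negRationalRealLoops {n : ℕ} (G : Subgroup (GL (Fin n) ℂ)) :
    Subgroup (LoopGerm n) :=
  holomorphicLoops G ⊓ rationalLoops n ⊓ negativeLoops n ⊓ realLoops n

/-! ### Complex coassociative planes and simple elements -/

/-- `ℂ⁷` with its standard hermitian inner product. -/
abbrev C7 : Type := EuclideanSpace ℂ (Fin 7)

/-- The complex conjugate of a subspace of `ℂ⁷`. -/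
def conjSubspace (W : Submodule ℂ C7) : Submodule ℂ C7 where
  carrier := {x | WithLp.toLp 2 (star x.ofLp) ∈ W}
  zero_mem' := by simp
  add_mem' := by
    intro x y hx hy
    simpa using W.add_mem hx hy
  smul_mem' := by
    intro c x hx
    simpa using W.smul_mem (star c) hx

/-- A complex coassociative plane: a two-dimensional subspace `W` of `ℂ⁷`, isotropic for the
complex bilinear form `⟨x, y⟩ = ∑ xᵢ yᵢ`, with `W · W = 0`. -/
structure IsComplexCoassociative (W : Submodule ℂ C7) : Prop where
  finrank_eq : Module.finrank ℂ W = 2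
  isotropic : ∀ x ∈ W, ∀ y ∈ W, x.ofLp ⬝ᵥ y.ofLp = 0
  imMul_eq_zero : ∀ x ∈ W, ∀ y ∈ W, imMul x.ofLp y.ofLp = 0

/-- The complex associative complement `(W ⊕ conj W)ᗮ`. -/
noncomputable def assocComplement (W : Submodule ℂ C7) : Submodule ℂ C7 := (W ⊔ conjSubspace W)ᗮ

/-- The matrix of the (hermitian) orthogonal projection onto `W`. -/
noncomputable def projMatrix (W : Submodule ℂ C7) : Matrix (Fin 7) (Fin 7) ℂ :=
  (Matrix.toEuclideanCLM (n := Fin 7) (𝕜 := ℂ)).symm W.starProjection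

/-- `r⁻¹ π_{conj W} + π_A + r π_W` with `A = (W ⊕ conj W)ᗮ`. -/
noncomputable def simpleMatrix (W : Submodule ℂ C7) (r : ℂ) : Matrix (Fin 7) (Fin 7) ℂ :=
  r⁻¹ • projMatrix (conjSubspace W) + projMatrix (assocComplement W) + r • projMatrix W

theorem projMatrix_mul_self (W : Submodule ℂ C7) : projMatrix W * projMatrix W = projMatrix W := by
  rw [projMatrix, ← map_mul]
  congr 1
  exact W.isIdempotentElem_starProjection

theorem projMatrix_mul_of_isOrtho {U W : Submodule ℂ C7} (h : U ⟂ W) :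
    projMatrix U * projMatrix W = 0 := by
  rw [projMatrix, projMatrix, ← map_mul]
  have : U.starProjection * W.starProjection = 0 := h.starProjection_comp_starProjection
  rw [this, map_zero]

theorem IsComplexCoassociative.isOrtho_conj {W : Submodule ℂ C7} (hW : IsComplexCoassociative W) :
    W ⟂ conjSubspace W := by
  rw [Submodule.isOrtho_iff_inner_eq]
  intro x hx y hy
  have h := hW.isotropic x hx _ hy
  have h2 : inner ℂ x y = star (x.ofLp ⬝ᵥ star y.ofLp) := by
    rw [EuclideanSpace.inner_eq_star_dotProduct]
    exact Matrix.dotProduct_star _ _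
  rw [h2, h, star_zero]

theorem IsComplexCoassociative.projMatrix_add {W : Submodule ℂ C7}
    (hW : IsComplexCoassociative W) :
    projMatrix (conjSubspace W) + projMatrix (assocComplement W) + projMatrix W = 1 := by
  have ho := hW.isOrtho_conj
  have key : (conjSubspace W).starProjection + (assocComplement W).starProjection
      + W.starProjection = 1 := by
    ext1 v
    have h1 : (W ⊔ conjSubspace W).starProjection v
        = W.starProjection v + (conjSubspace W).starProjection v := by
      refine Submodule.eq_starProjection_of_mem_of_inner_eq_zero ?_ ?_
      · exact Submodule.add_mem_sup (W.starProjection_apply_mem v)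
          ((conjSubspace W).starProjection_apply_mem v)
      · intro w hw
        obtain ⟨a, ha, b, hb, rfl⟩ := Submodule.mem_sup.mp hw
        have ea := W.starProjection_inner_eq_zero v a ha
        have eb := (conjSubspace W).starProjection_inner_eq_zero v b hb
        have ec := ho.symm.inner_eq ((conjSubspace W).starProjection_apply_mem v) ha
        have ed := ho.inner_eq (W.starProjection_apply_mem v) hb
        rw [inner_sub_left] at ea eb
        rw [inner_sub_left, inner_add_left, inner_add_right, inner_add_right, inner_add_right,
          ec, ed]
        linear_combination ea + eb
    have h2 := (W ⊔ conjSubspace W).starProjection_add_starProjection_orthogonal v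
    rw [h1] at h2
    change (conjSubspace W).starProjection v + ((W ⊔ conjSubspace W)ᗮ).starProjection v
      + W.starProjection v = v
    refine Eq.trans ?_ h2
    abel
  simp only [projMatrix, ← map_add, key, map_one]

theorem IsComplexCoassociative.simpleMatrix_mul_inv {W : Submodule ℂ C7}
    (hW : IsComplexCoassociative W) {r : ℂ} (hr : r ≠ 0) :
    simpleMatrix W r * simpleMatrix W r⁻¹ = 1 := by
  have ho := hW.isOrtho_conj
  have hA : W ⊔ conjSubspace W ⟂ assocComplement W := Submodule.isOrtho_orthogonal_right _
  have hWA : W ⟂ assocComplement W := hA.mono_left le_sup_left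
  have hCA : conjSubspace W ⟂ assocComplement W := hA.mono_left le_sup_right
  simp only [simpleMatrix, inv_inv, add_mul, mul_add, smul_mul_assoc, mul_smul_comm,
    projMatrix_mul_self, projMatrix_mul_of_isOrtho ho, projMatrix_mul_of_isOrtho ho.symm,
    projMatrix_mul_of_isOrtho hWA, projMatrix_mul_of_isOrtho hWA.symm,
    projMatrix_mul_of_isOrtho hCA, projMatrix_mul_of_isOrtho hCA.symm, smul_smul,
    mul_inv_cancel₀ hr, inv_mul_cancel₀ hr, smul_zero, one_smul, add_zero, zero_add]
  exact hW.projMatrix_add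

/-- `simpleMatrix` as an invertible matrix. -/
noncomputable def simpleGL (W : Submodule ℂ C7) (hW : IsComplexCoassociative W) (r : ℂ)
    (hr : r ≠ 0) : GL (Fin 7) ℂ where
  val := simpleMatrix W r
  inv := simpleMatrix W r⁻¹
  val_inv := hW.simpleMatrix_mul_inv hr
  inv_val := by simpa using hW.simpleMatrix_mul_inv (inv_ne_zero hr)

/-- The function `λ ↦ (λ - α) / (λ - conj α)` on `ℂP¹`, with value `1` at `∞`.  (It is only used
away from `α` and `conj α`.) -/
noncomputable def blaschke (α : ℂ) : OnePoint ℂ → ℂ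
  | ∞ => 1
  | (z : ℂ) => (z - α) / (z - starRingEnd ℂ α)

open Classical in
/-- The simple element
`p_{α,W}(λ) = (λ - conj α)/(λ - α) π_{conj W} + π_A + (λ - α)/(λ - conj α) π_W`,
which is defined for `λ ≠ α, conj α`; at these two points, which are irrelevant for the loop, the
value is set to `1`. -/
noncomputable def simpleElement (α : ℂ) (W : Submodule ℂ C7) (hW : IsComplexCoassociative W) :
    LoopGerm 7 :=
  ((fun p => if h : blaschke α p ≠ 0 then simpleGL W hW (blaschke α p) h else 1 :
    OnePoint ℂ → GL (Fin 7) ℂ) : LoopGerm 7)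

open Topology

/-! ### Identities for the product of imaginary octonions -/

theorem dotProduct_seven (x y : Fin 7 → ℂ) : x ⬝ᵥ y =
    x 0 * y 0 + x 1 * y 1 + x 2 * y 2 + x 3 * y 3 + x 4 * y 4 + x 5 * y 5 + x 6 * y 6 := by
  simp [dotProduct, Fin.sum_univ_seven]

theorem funext_seven {x y : Fin 7 → ℂ} (h0 : x 0 = y 0) (h1 : x 1 = y 1) (h2 : x 2 = y 2)
    (h3 : x 3 = y 3) (h4 : x 4 = y 4) (h5 : x 5 = y 5) (h6 : x 6 = y 6) : x = y := by
  ext i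
  fin_cases i <;> assumption

theorem imMul_zero_coord (x y : Fin 7 → ℂ) : imMul x y 0 =
  (x 4 * y 1 - x 1 * y 4) + (x 5 * y 2 - x 2 * y 5) + (x 6 * y 3 - x 3 * y 6) := rfl

theorem imMul_one_coord (x y : Fin 7 → ℂ) : imMul x y 1 =
    (x 0 * y 4 - x 4 * y 0) + (x 6 * y 2 - x 2 * y 6) + (x 3 * y 5 - x 5 * y 3) := rfl

theorem imMul_two_coord (x y : Fin 7 → ℂ) : imMul x y 2 =
    (x 0 * y 5 - x 5 * y 0) + (x 1 * y 6 - x 6 * y 1) + (x 4 * y 3 - x 3 * y 4) := rfl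

theorem imMul_three_coord (x y : Fin 7 → ℂ) : imMul x y 3 =
    (x 0 * y 6 - x 6 * y 0) + (x 5 * y 1 - x 1 * y 5) + (x 2 * y 4 - x 4 * y 2) := rfl

theorem imMul_four_coord (x y : Fin 7 → ℂ) : imMul x y 4 =
    (x 1 * y 0 - x 0 * y 1) + (x 3 * y 2 - x 2 * y 3) + (x 5 * y 6 - x 6 * y 5) := rfl

theorem imMul_five_coord (x y : Fin 7 → ℂ) : imMul x y 5 =
    (x 2 * y 0 - x 0 * y 2) + (x 1 * y 3 - x 3 * y 1) + (x 6 * y 4 - x 4 * y 6) := rfl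

theorem imMul_six_coord (x y : Fin 7 → ℂ) : imMul x y 6 =
    (x 3 * y 0 - x 0 * y 3) + (x 2 * y 1 - x 1 * y 2) + (x 4 * y 5 - x 5 * y 4) := rfl

/-- The alternative law polarised in the left factor. Setting `z = x` gives `imMul_imMul_self`,
which drives every statement about null vectors. -/
theorem imMul_imMul_add (x y z : Fin 7 → ℂ) : imMul x (imMul z y) + imMul z (imMul x y) =
   (-2 * (x ⬝ᵥ z)) • y + (x ⬝ᵥ y) • z + (z ⬝ᵥ y) • x := by
  apply funext_seven <;>
  simp only [Pi.add_apply, Pi.smul_apply, smul_eq_mul, imMul_zero_coord, imMul_one_coord,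
    imMul_two_coord, imMul_three_coord, imMul_four_coord, imMul_five_coord, imMul_six_coord,
    dotProduct_seven] <;> ring

/-- A Moufang-type identity. For null `x` and `a, b ⊥ x` only the multiple of `x` survives; this is
what excludes three-dimensional null subalgebras. -/
theorem imMul_imMul_imMul (x a b : Fin 7 → ℂ) : imMul (imMul x a) (imMul x b) =
    (2 * (x ⬝ᵥ imMul a b)) • x - (x ⬝ᵥ x) • imMul a b - (x ⬝ᵥ b) • imMul x a
      + (x ⬝ᵥ a) • imMul x b := by
  apply funext_seven <;>
  simp only [Pi.add_apply, Pi.sub_apply, Pi.smul_apply, smul_eq_mul, imMul_zero_coord, imMul_one_coord,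
    imMul_two_coord, imMul_three_coord, imMul_four_coord, imMul_five_coord, imMul_six_coord,
    dotProduct_seven] <;> ring

theorem imMul_comm (x y : Fin 7 → ℂ) : imMul x y = -imMul y x := by
  apply funext_seven <;>
  simp only [Pi.neg_apply, imMul_zero_coord, imMul_one_coord, imMul_two_coord, imMul_three_coord,
    imMul_four_coord, imMul_five_coord, imMul_six_coord] <;> ring

theorem dotProduct_imMul (x y z : Fin 7 → ℂ) : x ⬝ᵥ imMul y z = imMul x y ⬝ᵥ z := by
  simp only [imMul_zero_coord, imMul_one_coord, imMul_two_coord, imMul_three_coord,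
    imMul_four_coord, imMul_five_coord, imMul_six_coord, dotProduct_seven]
  ring

theorem imMul_star (x y : Fin 7 → ℂ) : imMul (star x) (star y) = star (imMul x y) := by
  apply funext_seven <;>
  simp only [Pi.star_apply, imMul_zero_coord, imMul_one_coord, imMul_two_coord, imMul_three_coord,
    imMul_four_coord, imMul_five_coord, imMul_six_coord, star_add, star_sub, star_mul']

/-- `imMul` as a bilinear map. -/
def imMulBilin : (Fin 7 → ℂ) →ₗ[ℂ] (Fin 7 → ℂ) →ₗ[ℂ] (Fin 7 → ℂ) :=
  LinearMap.mk₂ ℂ imMul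
    (fun x y z => by
      apply funext_seven <;>
      simp only [Pi.add_apply, imMul_zero_coord, imMul_one_coord, imMul_two_coord,
        imMul_three_coord, imMul_four_coord, imMul_five_coord, imMul_six_coord] <;> ring)
    (fun c x y => by
      apply funext_seven <;>
      simp only [Pi.smul_apply, smul_eq_mul, imMul_zero_coord, imMul_one_coord, imMul_two_coord,
        imMul_three_coord, imMul_four_coord, imMul_five_coord, imMul_six_coord] <;> ring)
    (fun x y z => by
      apply funext_seven <;>
      simp only [Pi.add_apply, imMul_zero_coord, imMul_one_coord, imMul_two_coord,
        imMul_three_coord, imMul_four_coord, imMul_five_coord, imMul_six_coord] <;> ring)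
    (fun c x y => by
      apply funext_seven <;>
      simp only [Pi.smul_apply, smul_eq_mul, imMul_zero_coord, imMul_one_coord, imMul_two_coord,
        imMul_three_coord, imMul_four_coord, imMul_five_coord, imMul_six_coord] <;> ring)

@[simp] theorem imMulBilin_apply (x y : Fin 7 → ℂ) : imMulBilin x y = imMul x y := rfl

theorem imMul_add (x y z : Fin 7 → ℂ) : imMul x (y + z) = imMul x y + imMul x z :=
  (imMulBilin x).map_add y z

theorem add_imMul (x y z : Fin 7 → ℂ) : imMul (x + y) z = imMul x z + imMul y z :=
  imMulBilin.map_add₂ x y z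

theorem imMul_smul (c : ℂ) (x y : Fin 7 → ℂ) : imMul x (c • y) = c • imMul x y :=
  (imMulBilin x).map_smul c y

theorem smul_imMul (c : ℂ) (x y : Fin 7 → ℂ) : imMul (c • x) y = c • imMul x y :=
  imMulBilin.map_smul₂ c x y

@[simp] theorem imMul_zero (x : Fin 7 → ℂ) : imMul x 0 = 0 := (imMulBilin x).map_zero

@[simp] theorem zero_imMul (x : Fin 7 → ℂ) : imMul 0 x = 0 := imMulBilin.map_zero₂ x

theorem imMul_neg (x y : Fin 7 → ℂ) : imMul x (-y) = -imMul x y := (imMulBilin x).map_neg y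

@[simp] theorem imMul_self (x : Fin 7 → ℂ) : imMul x x = 0 := by
  have h := imMul_comm x x
  have h2 : (2 : ℂ) • imMul x x = 0 := by
    rw [two_smul]
    nth_rewrite 1 [h]
    simp
  simpa using h2

theorem imMul_eq_zero_comm {x y : Fin 7 → ℂ} (h : imMul x y = 0) : imMul y x = 0 := by
  rw [imMul_comm, h, neg_zero]

theorem imMul_dotProduct (x y z : Fin 7 → ℂ) : imMul x y ⬝ᵥ z = -(y ⬝ᵥ imMul x z) := by
  rw [dotProduct_imMul, imMul_comm x y, neg_dotProduct]

theorem imMul_imMul_self (x y : Fin 7 → ℂ) :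
    imMul x (imMul x y) = (x ⬝ᵥ y) • x - (x ⬝ᵥ x) • y := by
  have h := imMul_imMul_add x y x
  have h2 : (2 : ℂ) • imMul x (imMul x y) = (2 : ℂ) • ((x ⬝ᵥ y) • x - (x ⬝ᵥ x) • y) := by
    rw [two_smul, h]
    module
  exact smul_right_injective _ (two_ne_zero) h2

/-! ### Null vectors and their annihilators -/

section null

variable {x : Fin 7 → ℂ}

theorem dotProduct_eq_zero_of_imMul_eq_zero (hx : x ≠ 0) (hxx : x ⬝ᵥ x = 0) {y : Fin 7 → ℂ}
    (hy : imMul x y = 0) : x ⬝ᵥ y = 0 := by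
  have h := imMul_imMul_self x y
  rw [hy, hxx, imMul_zero, zero_smul, sub_zero] at h
  exact (smul_eq_zero.mp h.symm).resolve_right hx

/-- The annihilator of a null vector is isotropic. -/
theorem dotProduct_eq_zero_of_mem_annihilator (hx : x ≠ 0) (hxx : x ⬝ᵥ x = 0)
    {y z : Fin 7 → ℂ} (hy : imMul x y = 0) (hz : imMul x z = 0) : y ⬝ᵥ z = 0 := by
  have hxy := dotProduct_eq_zero_of_imMul_eq_zero hx hxx hy
  have hxz := dotProduct_eq_zero_of_imMul_eq_zero hx hxx hz
  have h1 := imMul_imMul_add x y z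
  have h2 := imMul_imMul_add x z y
  rw [hy, hxz, hxy, imMul_zero] at h1
  rw [hz, hxz, hxy, imMul_zero, imMul_comm y z, imMul_neg, dotProduct_comm y z] at h2
  -- The polarised identity gives `x(zy) = ⟨z,y⟩ x`. Exchanging `y` and `z` reverses the sign on the
  -- left but not on the right.
  have h3 : (2 * (z ⬝ᵥ y)) • x = 0 := by
    have h4 : (z ⬝ᵥ y) • x = imMul x (imMul z y) := by simpa using h1.symm
    have h5 : (z ⬝ᵥ y) • x = -imMul x (imMul z y) := by simpa using h2.symm
    rw [two_mul, add_smul]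
    nth_rewrite 1 [h4]
    rw [h5, add_neg_cancel]
  rw [dotProduct_comm]
  simpa [hx] using h3

theorem finrank_le_three_of_isotropic (W : Submodule ℂ (Fin 7 → ℂ))
    (hW : ∀ y ∈ W, ∀ z ∈ W, y ⬝ᵥ z = 0) : Module.finrank ℂ W ≤ 3 := by
  have hB : (dotProductBilin ℂ ℂ : LinearMap.BilinForm ℂ (Fin 7 → ℂ)).Nondegenerate := by
    constructor
    · intro y hy
      exact dotProduct_eq_zero y hy
    · intro y hy
      exact dotProduct_eq_zero y fun w => by rw [dotProduct_comm]; exact hy w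
  have h := LinearMap.BilinForm.finrank_orthogonal hB W
  have hle : W ≤ LinearMap.BilinForm.orthogonal (dotProductBilin ℂ ℂ) W :=
    fun y hy z hz => hW z hz y hy
  have h2 := Submodule.finrank_mono hle
  rw [h, Module.finrank_fin_fun] at h2
  omega

theorem six_le_finrank_ker (f : (Fin 7 → ℂ) →ₗ[ℂ] ℂ) : 6 ≤ Module.finrank ℂ (LinearMap.ker f) := by
  have h := f.finrank_range_add_finrank_ker
  have h2 := Submodule.finrank_le (LinearMap.range f)
  rw [Module.finrank_fin_fun] at h
  rw [Module.finrank_self] at h2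
  omega

theorem finrank_ker_domRestrict_le (f : (Fin 7 → ℂ) →ₗ[ℂ] (Fin 7 → ℂ))
    (K : Submodule ℂ (Fin 7 → ℂ)) :
    Module.finrank ℂ (LinearMap.ker (f.domRestrict K)) ≤ Module.finrank ℂ (LinearMap.ker f) := by
  rw [← Submodule.finrank_map_subtype_eq K]
  apply Submodule.finrank_mono
  rintro _ ⟨a, ha, rfl⟩
  exact ha

/-- The upper bound is isotropy in dimension seven. For the lower bound, multiplication by `x` on
`xᗮ` (dimension at least six) squares to zero, so both its kernel and its image lie in the
annihilator. -/
theorem finrank_annihilator (hx : x ≠ 0) (hxx : x ⬝ᵥ x = 0) :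
    Module.finrank ℂ (LinearMap.ker (imMulBilin x)) = 3 := by
  apply le_antisymm
  · exact finrank_le_three_of_isotropic _ fun y hy z hz =>
      dotProduct_eq_zero_of_mem_annihilator hx hxx hy hz
  · set K := LinearMap.ker (dotProductBilin ℂ ℂ x) with hK
    have h6 : 6 ≤ Module.finrank ℂ K := six_le_finrank_ker _
    have h := ((imMulBilin x).domRestrict K).finrank_range_add_finrank_ker
    have hr : LinearMap.range ((imMulBilin x).domRestrict K) ≤ LinearMap.ker (imMulBilin x) := by
      rintro _ ⟨⟨a, ha⟩, rfl⟩
      have ha' : x ⬝ᵥ a = 0 := ha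
      simp [imMul_imMul_self, hxx, ha']
    have hk := finrank_ker_domRestrict_le (imMulBilin x) K
    have := Submodule.finrank_mono hr
    omega

theorem exists_mem_annihilator (hx : x ≠ 0) (hxx : x ⬝ᵥ x = 0) (f g : (Fin 7 → ℂ) →ₗ[ℂ] ℂ) :
    ∃ v ≠ 0, imMul x v = 0 ∧ f v = 0 ∧ g v = 0 := by
  have h3 := finrank_annihilator hx hxx
  set N := LinearMap.ker (imMulBilin x)
  have h : LinearMap.ker ((f.prod g).domRestrict N) ≠ ⊥ := by
    apply LinearMap.ker_ne_bot_of_finrank_lt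
    rw [h3, Module.finrank_prod, Module.finrank_self]
    norm_num
  obtain ⟨⟨v, hv⟩, hv1, hv0⟩ := Submodule.exists_mem_ne_zero_of_ne_bot h
  have hv2 : (f v, g v) = 0 := hv1
  rw [Prod.mk_eq_zero] at hv2
  exact ⟨v, fun h => hv0 (by simp [h]), hv, hv2.1, hv2.2⟩

/-- The image of `xᗮ` under multiplication by a null vector `x` is the annihilator of `x`. -/
theorem exists_imMul_eq (hx : x ≠ 0) (hxx : x ⬝ᵥ x = 0) {y : Fin 7 → ℂ} (hy : imMul x y = 0) :
    ∃ a, x ⬝ᵥ a = 0 ∧ imMul x a = y := by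
  set K := LinearMap.ker (dotProductBilin ℂ ℂ x) with hK
  have h6 : 6 ≤ Module.finrank ℂ K := six_le_finrank_ker _
  have h := ((imMulBilin x).domRestrict K).finrank_range_add_finrank_ker
  have hr : LinearMap.range ((imMulBilin x).domRestrict K) ≤ LinearMap.ker (imMulBilin x) := by
    rintro _ ⟨⟨a, ha⟩, rfl⟩
    have ha' : x ⬝ᵥ a = 0 := ha
    simp [imMul_imMul_self, hxx, ha']
  have hk := finrank_ker_domRestrict_le (imMulBilin x) K
  have h3 := finrank_annihilator hx hxx
  have := Submodule.finrank_mono hr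
  have heq := Submodule.eq_of_le_of_finrank_eq hr (by omega)
  have hy' : y ∈ LinearMap.range ((imMulBilin x).domRestrict K) := by rw [heq]; exact hy
  obtain ⟨⟨a, ha⟩, hay⟩ := hy'
  exact ⟨a, ha, hay⟩

open scoped ComplexOrder in
theorem star_dotProduct_self_ne_zero (hx : x ≠ 0) : star x ⬝ᵥ x ≠ 0 :=
  fun h => hx (dotProduct_star_self_eq_zero.mp h)

theorem mem_span_of_dotProduct (hx : x ≠ 0) {y : Fin 7 → ℂ}
    (h : ∀ b, x ⬝ᵥ b = 0 → y ⬝ᵥ b = 0) : ∃ c : ℂ, y = c • x := by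
  have hs := star_dotProduct_self_ne_zero hx
  refine ⟨(star x ⬝ᵥ y) / (star x ⬝ᵥ x), ?_⟩
  rw [← sub_eq_zero]
  apply dotProduct_eq_zero
  intro w
  -- Since `x` may be null, `w` is made orthogonal to `x` by subtracting a multiple of `star x`, not
  -- of `x`.
  have h2 := h (w - ((x ⬝ᵥ w) / (star x ⬝ᵥ x)) • star x) (by
    rw [dotProduct_sub, dotProduct_smul, smul_eq_mul, dotProduct_comm x (star x)]
    field_simp
    ring)
  rw [dotProduct_sub, dotProduct_smul, smul_eq_mul, dotProduct_comm y (star x)] at h2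
  rw [sub_dotProduct, smul_dotProduct, smul_eq_mul]
  linear_combination h2

/-- There are no three-dimensional null subalgebras. -/
theorem mem_span_of_imMul_eq_zero (hx : x ≠ 0) (hxx : x ⬝ᵥ x = 0) {y z : Fin 7 → ℂ}
    (hxy : imMul x y = 0) (hxz : imMul x z = 0) (hyz : imMul y z = 0)
    (hli : ∀ c : ℂ, y ≠ c • x) : ∃ c d : ℂ, z = c • x + d • y := by
  by_contra! hz
  have hlin : LinearIndependent ℂ ![x, y, z] := by
    rw [Fintype.linearIndependent_iff]
    intro g hg
    replace hg : g 0 • x + g 1 • y + g 2 • z = 0 := (Fin.sum_univ_three _).symm.trans hg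
    have h2 : g 2 = 0 := by
      by_contra h
      apply hz (-(g 0) / g 2) (-(g 1) / g 2)
      have : z = (g 2)⁻¹ • (g 2 • z) := by rw [smul_smul, inv_mul_cancel₀ h, one_smul]
      rw [this, eq_neg_of_add_eq_zero_right hg]
      module
    have h1 : g 1 = 0 := by
      by_contra h
      apply hli (-(g 0) / g 1)
      have : y = (g 1)⁻¹ • (g 1 • y) := by rw [smul_smul, inv_mul_cancel₀ h, one_smul]
      rw [h2, zero_smul, add_zero] at hg
      rw [this, eq_neg_of_add_eq_zero_right hg]
      module
    have h0 : g 0 = 0 := by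
      simpa [h1, h2, hx] using hg
    intro i
    fin_cases i <;> assumption
  -- If independent, the three vectors fill the annihilator of `x`. Writing `y = x·a`, `z = x·b`,
  -- the relation `y·z = 0` becomes `⟨x, a·b⟩ = 0`.
  have hspan : Submodule.span ℂ (Set.range ![x, y, z]) = LinearMap.ker (imMulBilin x) := by
    apply Submodule.eq_of_le_of_finrank_eq
    · rw [Submodule.span_le]
      rintro _ ⟨i, rfl⟩
      fin_cases i <;> simp [hxy, hxz]
    · rw [finrank_annihilator hx hxx, finrank_span_eq_card hlin, Fintype.card_fin]
  obtain ⟨a, ha, rfl⟩ := exists_imMul_eq hx hxx hxy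
  obtain ⟨b, hb, rfl⟩ := exists_imMul_eq hx hxx hxz
  have hab : x ⬝ᵥ imMul a b = 0 := by
    rw [imMul_imMul_imMul, hxx, ha, hb] at hyz
    simpa [hx] using hyz
  -- For `w ⊥ x` one has `⟨x·a, w⟩ = -⟨a, x·w⟩`, and `x·w` lies in the span of `x`, `x·a`, `x·b`,
  -- all orthogonal to `a`. Hence `x·a` is a multiple of `x`, a contradiction.
  obtain ⟨c, hc⟩ := mem_span_of_dotProduct (y := imMul x a) hx (fun w hw => by
    have hm : imMul x w ∈ Submodule.span ℂ (Set.range ![x, imMul x a, imMul x b]) := by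
      rw [hspan]
      simp [imMul_imMul_self, hxx, hw]
    obtain ⟨g, hg⟩ := (Submodule.mem_span_range_iff_exists_fun ℂ).mp hm
    replace hg : g 0 • x + g 1 • imMul x a + g 2 • imMul x b = imMul x w :=
      (Fin.sum_univ_three _).symm.trans hg
    have haa : a ⬝ᵥ imMul x a = 0 := by
      rw [dotProduct_imMul, imMul_dotProduct, imMul_self, dotProduct_zero, neg_zero]
    have hab' : a ⬝ᵥ imMul x b = 0 := by
      rw [dotProduct_imMul, imMul_comm, neg_dotProduct, ← dotProduct_imMul, hab, neg_zero]
    rw [imMul_dotProduct, ← hg, dotProduct_add, dotProduct_add, dotProduct_smul, dotProduct_smul,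
      dotProduct_smul, dotProduct_comm a x, ha, haa, hab']
    simp)
  exact hli c hc

/-- A hyperplane of `ℂ⁷` is not closed under multiplication. -/
theorem exists_dotProduct_imMul_ne_zero {n : Fin 7 → ℂ} (hn : n ≠ 0) :
    ∃ y z, n ⬝ᵥ y = 0 ∧ n ⬝ᵥ z = 0 ∧ n ⬝ᵥ imMul y z ≠ 0 := by
  by_contra! h
  -- If `nᗮ` were closed under products, multiplication by `n` would map it into the line of `n`.
  -- This forces `n` to be null, and then the kernel would have dimension at least five instead of
  -- three.
  have h1 : ∀ y, n ⬝ᵥ y = 0 → ∃ c : ℂ, imMul n y = c • n := fun y hy =>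
    mem_span_of_dotProduct hn fun z hz => by rw [← dotProduct_imMul, h y z hy hz]
  have h6 := six_le_finrank_ker (dotProductBilin ℂ ℂ n)
  set K := LinearMap.ker (dotProductBilin ℂ ℂ n) with hK
  have hnn : n ⬝ᵥ n = 0 := by
    have hne : K ≠ ⊥ := by
      intro h0
      rw [h0, finrank_bot] at h6
      omega
    obtain ⟨y, hy, hy0⟩ := Submodule.exists_mem_ne_zero_of_ne_bot hne
    have hy' : n ⬝ᵥ y = 0 := hy
    obtain ⟨c, hc⟩ := h1 y hy
    have h2 := imMul_imMul_self n y
    rw [hc, imMul_smul, imMul_self, hy'] at h2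
    simpa [hy0] using h2.symm
  have hr := ((imMulBilin n).domRestrict K).finrank_range_add_finrank_ker
  have hle : LinearMap.range ((imMulBilin n).domRestrict K) ≤ Submodule.span ℂ {n} := by
    rintro _ ⟨⟨a, ha⟩, rfl⟩
    obtain ⟨c, hc⟩ := h1 a ha
    simp only [LinearMap.domRestrict_apply, imMulBilin_apply, hc]
    exact Submodule.smul_mem _ _ (Submodule.mem_span_singleton_self n)
  have h2 := Submodule.finrank_mono hle
  rw [finrank_span_singleton hn] at h2
  have hk := finrank_ker_domRestrict_le (imMulBilin n) K
  rw [finrank_annihilator hn hnn] at hk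
  omega

end null

/-! ### Orthogonal projections in coordinates -/

theorem projMatrix_mulVec (W : Submodule ℂ C7) (v : Fin 7 → ℂ) :
    projMatrix W *ᵥ v = (W.starProjection (WithLp.toLp 2 v)).ofLp := by
  rw [projMatrix, ← Matrix.ofLp_toEuclideanCLM _ (WithLp.toLp 2 v), StarAlgEquiv.apply_symm_apply]

theorem projMatrix_mulVec_mem (W : Submodule ℂ C7) (v : Fin 7 → ℂ) :
    WithLp.toLp 2 (projMatrix W *ᵥ v) ∈ W := by
  rw [projMatrix_mulVec]
  exact W.starProjection_apply_mem _

theorem projMatrix_mulVec_of_mem {W : Submodule ℂ C7} {v : Fin 7 → ℂ}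
    (hv : WithLp.toLp 2 v ∈ W) : projMatrix W *ᵥ v = v := by
  rw [projMatrix_mulVec, Submodule.starProjection_eq_self_iff.mpr hv]

theorem projMatrix_mulVec_eq_zero {W : Submodule ℂ C7} {v : Fin 7 → ℂ}
    (hv : ∀ w, WithLp.toLp 2 w ∈ W → star w ⬝ᵥ v = 0) : projMatrix W *ᵥ v = 0 := by
  rw [projMatrix_mulVec, (Submodule.starProjection_apply_eq_zero_iff W).mpr, WithLp.ofLp_zero]
  rw [Submodule.mem_orthogonal]
  intro u hu
  rw [EuclideanSpace.inner_eq_star_dotProduct, dotProduct_comm]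
  exact hv _ hu

theorem toLp_mem_conjSubspace {W : Submodule ℂ C7} {v : Fin 7 → ℂ} :
    WithLp.toLp 2 v ∈ conjSubspace W ↔ WithLp.toLp 2 (star v) ∈ W := Iff.rfl

theorem toLp_mem_assocComplement {W : Submodule ℂ C7} {v : Fin 7 → ℂ} :
    WithLp.toLp 2 v ∈ assocComplement W ↔
      ∀ w, WithLp.toLp 2 w ∈ W → w ⬝ᵥ v = 0 ∧ star w ⬝ᵥ v = 0 := by
  rw [assocComplement, Submodule.mem_orthogonal]
  constructor
  · intro h w hw
    have h1 := h (WithLp.toLp 2 w) (Submodule.mem_sup_left hw)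
    have h2 := h (WithLp.toLp 2 (star w)) (Submodule.mem_sup_right (by
      rwa [toLp_mem_conjSubspace, star_star]))
    rw [EuclideanSpace.inner_eq_star_dotProduct, dotProduct_comm] at h1 h2
    exact ⟨by simpa using h2, h1⟩
  · intro h u hu
    obtain ⟨a, ha, b, hb, rfl⟩ := Submodule.mem_sup.mp hu
    rw [inner_add_left, EuclideanSpace.inner_eq_star_dotProduct,
      EuclideanSpace.inner_eq_star_dotProduct, dotProduct_comm, dotProduct_comm v,
      (h _ ha).2]
    have := (h _ hb).1
    simp only at this
    rw [this, add_zero]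

theorem star_mem_assocComplement {W : Submodule ℂ C7} {v : Fin 7 → ℂ}
    (hv : WithLp.toLp 2 v ∈ assocComplement W) : WithLp.toLp 2 (star v) ∈ assocComplement W := by
  rw [toLp_mem_assocComplement] at hv ⊢
  intro w hw
  obtain ⟨h1, h2⟩ := hv w hw
  refine ⟨?_, ?_⟩
  · have := congrArg star h2
    rwa [Matrix.star_dotProduct, star_star, star_zero, dotProduct_comm] at this
  · rw [Matrix.star_dotProduct_star, dotProduct_comm, h1, star_zero]

theorem simpleMatrix_mulVec (W : Submodule ℂ C7) (r : ℂ) (v : Fin 7 → ℂ) :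
    simpleMatrix W r *ᵥ v = r⁻¹ • projMatrix (conjSubspace W) *ᵥ v
      + projMatrix (assocComplement W) *ᵥ v + r • projMatrix W *ᵥ v := by
  simp only [simpleMatrix, Matrix.add_mulVec, Matrix.smul_mulVec]

/-! ### The grading defined by a complex coassociative plane -/

/-- The product `c·a` is annihilated by both `c` and `c'`, so the absence of three-dimensional null
subalgebras places it in their span. -/
theorem exists_imMul_eq_of_null_pair {c c' a : Fin 7 → ℂ} (hc : c ≠ 0) (hcc : c ⬝ᵥ c = 0)
    (hcc' : c ⬝ᵥ c' = 0) (hc'c' : c' ⬝ᵥ c' = 0) (hm : imMul c c' = 0) (hli : ∀ p : ℂ, c' ≠ p • c)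
    (ha : c ⬝ᵥ a = 0) (ha' : c' ⬝ᵥ a = 0) : ∃ p q : ℂ, imMul c a = p • c + q • c' := by
  have hm' := imMul_eq_zero_comm hm
  have hmem : ∀ z, imMul c z = 0 → imMul c' z = 0 → ∃ p q : ℂ, z = p • c + q • c' :=
    fun z h1 h2 => mem_span_of_imMul_eq_zero hc hcc hm h1 h2 hli
  apply hmem
  · rw [imMul_imMul_self, ha, hcc, zero_smul, zero_smul, sub_zero]
  apply dotProduct_eq_zero
  intro b
  have h0 : c' ⬝ᵥ imMul c b = 0 := by rw [dotProduct_imMul, hm', zero_dotProduct]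
  have h0' : c ⬝ᵥ imMul c b = 0 := by rw [dotProduct_imMul, imMul_self, zero_dotProduct]
  -- Testing `c'(c a)` against `b` moves both factors across: `⟨c'(c a), b⟩ = ⟨a, c(c' b)⟩`. The
  -- polarised identity trades `c(c' b)` for `-c'(c b)` plus multiples of `c, c'`, and `c'(c b)` is
  -- itself in their span, hence orthogonal to `a`.
  obtain ⟨p, q, hpq⟩ := hmem (imMul c' (imMul c b))
    (by
      have h := imMul_imMul_add c (imMul c b) c'
      rw [imMul_imMul_self c b, h0, h0', hcc, hcc', zero_smul, sub_zero, imMul_smul, hm'] at h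
      simpa using h)
    (by rw [imMul_imMul_self, h0, hc'c', zero_smul, zero_smul, sub_zero])
  have h := imMul_imMul_add c b c'
  rw [imMul_dotProduct, imMul_dotProduct, neg_neg, eq_sub_of_add_eq h, hpq, hcc']
  simp only [mul_zero, zero_smul, zero_add, dotProduct_sub, dotProduct_add, dotProduct_smul,
    dotProduct_comm a c, dotProduct_comm a c', ha, ha', smul_zero, add_zero, sub_zero]

theorem exists_of_finrank_eq_two {W : Submodule ℂ C7} (hW : Module.finrank ℂ W = 2)
    (c : Fin 7 → ℂ) : ∃ c', WithLp.toLp 2 c' ∈ W ∧ ∀ p : ℂ, c' ≠ p • c := by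
  by_contra! h
  have hle : W ≤ Submodule.span ℂ {WithLp.toLp 2 c} := by
    intro w hw
    obtain ⟨p, hp⟩ := h w.ofLp hw
    rw [Submodule.mem_span_singleton]
    exact ⟨p, by rw [← WithLp.toLp_smul, ← hp]⟩
  have h1 := Submodule.finrank_mono hle
  have h2 := finrank_span_le_card (R := ℂ) {(WithLp.toLp 2 c : C7)}
  rw [Set.toFinset_singleton, Finset.card_singleton] at h2
  rw [hW] at h1
  exact absurd (h1.trans h2) (by norm_num)

namespace IsComplexCoassociative

variable {W : Submodule ℂ C7}

theorem dotProduct_eq_zero (hW : IsComplexCoassociative W) {x y : Fin 7 → ℂ}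
    (hx : WithLp.toLp 2 x ∈ W)
    (hy : WithLp.toLp 2 y ∈ W) : x ⬝ᵥ y = 0 := hW.isotropic _ hx _ hy

theorem imMul_mem (hW : IsComplexCoassociative W) {c a : Fin 7 → ℂ} (hc : WithLp.toLp 2 c ∈ W)
    (ha : ∀ w, WithLp.toLp 2 w ∈ W → w ⬝ᵥ a = 0) : WithLp.toLp 2 (imMul c a) ∈ W := by
  by_cases hc0 : c = 0
  · rw [hc0, zero_imMul, WithLp.toLp_zero]
    exact W.zero_mem
  obtain ⟨c', hc', hli⟩ := exists_of_finrank_eq_two hW.finrank_eq c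
  obtain ⟨p, q, h⟩ := exists_imMul_eq_of_null_pair hc0 (hW.dotProduct_eq_zero hc hc)
    (hW.dotProduct_eq_zero hc hc') (hW.dotProduct_eq_zero hc' hc')
    (hW.imMul_eq_zero _ hc _ hc') hli (ha c hc) (ha c' hc')
  rw [h, WithLp.toLp_add, WithLp.toLp_smul, WithLp.toLp_smul]
  exact W.add_mem (W.smul_mem _ hc) (W.smul_mem _ hc')

theorem projMatrix_decomp
    (hW : IsComplexCoassociative W) (v : Fin 7 → ℂ) : projMatrix (conjSubspace W) *ᵥ v
    + projMatrix (assocComplement W) *ᵥ v + projMatrix W *ᵥ v = v := by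
  rw [← Matrix.add_mulVec, ← Matrix.add_mulVec, hW.projMatrix_add, Matrix.one_mulVec]

theorem _root_.projMatrix_conj_mulVec {v : Fin 7 → ℂ} (hv : ∀ w, WithLp.toLp 2 w ∈ W → w ⬝ᵥ v = 0) :
    projMatrix (conjSubspace W) *ᵥ v = 0 :=
  projMatrix_mulVec_eq_zero fun _ hw => hv _ hw

theorem _root_.projMatrix_assoc_mulVec {v : Fin 7 → ℂ} (hv : WithLp.toLp 2 v ∈ W) :
    projMatrix (assocComplement W) *ᵥ v = 0 :=
  projMatrix_mulVec_eq_zero fun w hw => by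
    have := (toLp_mem_assocComplement.mp hw v hv).2
    rw [Matrix.star_dotProduct, this, star_zero]

theorem simpleMatrix_mulVec_of_mem (hW : IsComplexCoassociative W) (r : ℂ) {v : Fin 7 → ℂ}
    (hv : WithLp.toLp 2 v ∈ W) :
    simpleMatrix W r *ᵥ v = r • v := by
  rw [simpleMatrix_mulVec, projMatrix_assoc_mulVec hv, projMatrix_mulVec_of_mem hv,
    projMatrix_conj_mulVec fun w hw => hW.dotProduct_eq_zero hw hv]
  simp

theorem simpleMatrix_mulVec_of_star_mem (hW : IsComplexCoassociative W) (r : ℂ) {v : Fin 7 → ℂ}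
    (hv : WithLp.toLp 2 (star v) ∈ W) : simpleMatrix W r *ᵥ v = r⁻¹ • v := by
  rw [simpleMatrix_mulVec, projMatrix_mulVec_of_mem (W := conjSubspace W) hv,
    projMatrix_mulVec_eq_zero (W := W), projMatrix_mulVec_eq_zero (W := assocComplement W)]
  · simp
  · intro w hw
    have := (toLp_mem_assocComplement.mp hw _ hv).1
    rw [Matrix.star_dotProduct, this, star_zero]
  · intro w hw
    have := hW.dotProduct_eq_zero hv hw
    rw [Matrix.star_dotProduct, this, star_zero]

theorem _root_.simpleMatrix_mulVec_of_mem_assoc (r : ℂ) {v : Fin 7 → ℂ}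
    (hv : WithLp.toLp 2 v ∈ assocComplement W) : simpleMatrix W r *ᵥ v = v := by
  have h := toLp_mem_assocComplement.mp hv
  rw [simpleMatrix_mulVec, projMatrix_mulVec_of_mem hv,
    projMatrix_conj_mulVec fun w hw => (h w hw).1,
    projMatrix_mulVec_eq_zero (W := W) fun w hw => (h w hw).2]
  simp

/-- Products add the weights `1, 0, -1` of `W`, `A`, `conj W` and vanish when the sum is `±2`.
Inclusions landing in `A` follow by moving a factor across the form, those for `conj W` by
conjugation. -/
theorem simpleMatrix_imMul (hW : IsComplexCoassociative W) {r : ℂ} (hr : r ≠ 0) (u v : Fin 7 → ℂ) :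
    simpleMatrix W r *ᵥ imMul u v = imMul (simpleMatrix W r *ᵥ u) (simpleMatrix W r *ᵥ v) := by
  have hCA : ∀ {c a : Fin 7 → ℂ}, WithLp.toLp 2 c ∈ W → WithLp.toLp 2 a ∈ assocComplement W →
      WithLp.toLp 2 (imMul c a) ∈ W := fun hc ha =>
    hW.imMul_mem hc fun w hw => (toLp_mem_assocComplement.mp ha w hw).1
  have hDA : ∀ {c a : Fin 7 → ℂ}, WithLp.toLp 2 (star c) ∈ W →
      WithLp.toLp 2 a ∈ assocComplement W → WithLp.toLp 2 (star (imMul c a)) ∈ W := fun hc ha => by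
    rw [← imMul_star]
    exact hCA hc (star_mem_assocComplement ha)
  have hAA : ∀ {a b : Fin 7 → ℂ}, WithLp.toLp 2 a ∈ assocComplement W →
      WithLp.toLp 2 b ∈ assocComplement W → WithLp.toLp 2 (imMul a b) ∈ assocComplement W := by
    intro a b ha hb
    rw [toLp_mem_assocComplement]
    intro w hw
    refine ⟨?_, ?_⟩
    · rw [dotProduct_imMul]
      exact (toLp_mem_assocComplement.mp hb _ (hCA hw ha)).1
    · rw [dotProduct_imMul]
      have h := (toLp_mem_assocComplement.mp hb _
        (hDA (c := star w) (by rwa [star_star]) ha)).2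
      rwa [star_star] at h
  have hCD : ∀ {c d : Fin 7 → ℂ}, WithLp.toLp 2 c ∈ W → WithLp.toLp 2 (star d) ∈ W →
      WithLp.toLp 2 (imMul c d) ∈ assocComplement W := by
    intro c d hc hd
    rw [toLp_mem_assocComplement]
    intro w hw
    refine ⟨?_, ?_⟩
    · rw [dotProduct_imMul, hW.imMul_eq_zero _ hw _ hc, zero_dotProduct]
    · have h := hW.imMul_eq_zero _ hd _ hw
      have h2 : imMul d (star w) = 0 := by
        have := congrArg star h
        rwa [← imMul_star, star_star, star_zero] at this
      rw [dotProduct_comm, ← dotProduct_imMul, h2, dotProduct_zero]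
  have hDD : ∀ {c d : Fin 7 → ℂ}, WithLp.toLp 2 (star c) ∈ W → WithLp.toLp 2 (star d) ∈ W →
      imMul c d = 0 := by
    intro c d hc hd
    have := congrArg star (hW.imMul_eq_zero _ hc _ hd)
    rwa [← imMul_star, star_star, star_star, star_zero] at this
  have hu := hW.projMatrix_decomp u
  have hv := hW.projMatrix_decomp v
  have hu1 : WithLp.toLp 2 (star (projMatrix (conjSubspace W) *ᵥ u)) ∈ W :=
    projMatrix_mulVec_mem (conjSubspace W) u
  have hv1 : WithLp.toLp 2 (star (projMatrix (conjSubspace W) *ᵥ v)) ∈ W :=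
    projMatrix_mulVec_mem (conjSubspace W) v
  have hu2 := projMatrix_mulVec_mem (assocComplement W) u
  have hv2 := projMatrix_mulVec_mem (assocComplement W) v
  have hu3 := projMatrix_mulVec_mem W u
  have hv3 := projMatrix_mulVec_mem W v
  rw [simpleMatrix_mulVec W r u, simpleMatrix_mulVec W r v]
  conv_lhs => rw [← hu, ← hv]
  generalize projMatrix (conjSubspace W) *ᵥ u = u1 at *
  generalize projMatrix (conjSubspace W) *ᵥ v = v1 at *
  generalize projMatrix (assocComplement W) *ᵥ u = u2 at *
  generalize projMatrix (assocComplement W) *ᵥ v = v2 at *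
  generalize projMatrix W *ᵥ u = u3 at *
  generalize projMatrix W *ᵥ v = v3 at *
  have h33 : imMul u3 v3 = 0 := hW.imMul_eq_zero _ hu3 _ hv3
  have h21 : imMul u2 v1 = -imMul v1 u2 := imMul_comm _ _
  have h23 : imMul u2 v3 = -imMul v3 u2 := imMul_comm _ _
  have h13 : imMul u1 v3 = -imMul v3 u1 := imMul_comm _ _
  simp only [imMul_add, add_imMul, imMul_smul, smul_imMul, hDD hu1 hv1, h33, h21, h23, h13,
    Matrix.mulVec_add, Matrix.mulVec_neg, Matrix.mulVec_zero, smul_zero,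
    hW.simpleMatrix_mulVec_of_mem r (hCA hu3 hv2), hW.simpleMatrix_mulVec_of_mem r (hCA hv3 hu2),
    hW.simpleMatrix_mulVec_of_star_mem r (hDA hu1 hv2),
    hW.simpleMatrix_mulVec_of_star_mem r (hDA hv1 hu2),
    simpleMatrix_mulVec_of_mem_assoc r (hAA hu2 hv2),
    simpleMatrix_mulVec_of_mem_assoc r (hCD hu3 hv1),
    simpleMatrix_mulVec_of_mem_assoc r (hCD hv3 hu1), smul_neg, smul_add, smul_smul,
    mul_inv_cancel₀ hr, inv_mul_cancel₀ hr, one_smul]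

theorem simpleMatrix_dotProduct (hW : IsComplexCoassociative W) {r : ℂ}
    (hr : r ≠ 0) (u v : Fin 7 → ℂ) :
    (simpleMatrix W r *ᵥ u) ⬝ᵥ (simpleMatrix W r *ᵥ v) = u ⬝ᵥ v := by
  have hu := hW.projMatrix_decomp u
  have hv := hW.projMatrix_decomp v
  have hu1 : WithLp.toLp 2 (star (projMatrix (conjSubspace W) *ᵥ u)) ∈ W :=
    projMatrix_mulVec_mem (conjSubspace W) u
  have hv1 : WithLp.toLp 2 (star (projMatrix (conjSubspace W) *ᵥ v)) ∈ W :=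
    projMatrix_mulVec_mem (conjSubspace W) v
  have hu2 := toLp_mem_assocComplement.mp (projMatrix_mulVec_mem (assocComplement W) u)
  have hv2 := toLp_mem_assocComplement.mp (projMatrix_mulVec_mem (assocComplement W) v)
  have hu3 := projMatrix_mulVec_mem W u
  have hv3 := projMatrix_mulVec_mem W v
  rw [simpleMatrix_mulVec W r u, simpleMatrix_mulVec W r v]
  conv_rhs => rw [← hu, ← hv]
  generalize projMatrix (conjSubspace W) *ᵥ u = u1 at *
  generalize projMatrix (conjSubspace W) *ᵥ v = v1 at *
  generalize projMatrix (assocComplement W) *ᵥ u = u2 at *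
  generalize projMatrix (assocComplement W) *ᵥ v = v2 at *
  generalize projMatrix W *ᵥ u = u3 at *
  generalize projMatrix W *ᵥ v = v3 at *
  have h11 : u1 ⬝ᵥ v1 = 0 := by
    have := hW.dotProduct_eq_zero hu1 hv1
    rwa [Matrix.star_dotProduct_star, star_eq_zero, dotProduct_comm] at this
  have h12 : u1 ⬝ᵥ v2 = 0 := by simpa using (hv2 _ hu1).2
  have h21 : u2 ⬝ᵥ v1 = 0 := by rw [dotProduct_comm]; simpa using (hu2 _ hv1).2
  have h23 : u2 ⬝ᵥ v3 = 0 := by rw [dotProduct_comm]; exact (hu2 _ hv3).1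
  simp only [add_dotProduct, dotProduct_add, smul_dotProduct, dotProduct_smul, h11, h12, h21, h23,
    (hv2 _ hu3).1, hW.dotProduct_eq_zero hu3 hv3, smul_zero, smul_smul, mul_inv_cancel₀ hr,
    inv_mul_cancel₀ hr, one_smul, add_zero, zero_add]

end IsComplexCoassociative

/-! ### Elements of the complex group `G₂` and planes spanned by null pairs. -/

theorem mem_complexG2_iff {A : GL (Fin 7) ℂ} : A ∈ complexG2 ↔
    (∀ u v, (A.1 *ᵥ u) ⬝ᵥ (A.1 *ᵥ v) = u ⬝ᵥ v) ∧
      ∀ u v, A.1 *ᵥ imMul u v = imMul (A.1 *ᵥ u) (A.1 *ᵥ v) := by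
  constructor
  · intro h
    have h' : ∀ u v : Fin 7 → ℂ, _ := fun u v => h (0, u) (0, v)
    simp only [octExtend, octMul, Prod.mk.injEq, mul_zero, zero_sub, zero_smul, zero_add,
      neg_inj] at h'
    exact ⟨fun u v => (h' u v).1.symm, fun u v => (h' u v).2⟩
  · rintro ⟨h1, h2⟩ p q
    simp only [octExtend, octMul, h1, Matrix.mulVec_add, Matrix.mulVec_smul, h2]

theorem simpleGL_mem_complexG2 {W : Submodule ℂ C7} (hW : IsComplexCoassociative W) {r : ℂ}
    (hr : r ≠ 0) : simpleGL W hW r hr ∈ complexG2 :=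
  mem_complexG2_iff.mpr ⟨hW.simpleMatrix_dotProduct hr, hW.simpleMatrix_imMul hr⟩

theorem isComplexCoassociative_span {x c : Fin 7 → ℂ} (hx : x ≠ 0) (hxx : x ⬝ᵥ x = 0)
    (hxc : x ⬝ᵥ c = 0) (hcc : c ⬝ᵥ c = 0) (hm : imMul x c = 0) (hli : ∀ p : ℂ, c ≠ p • x) :
    IsComplexCoassociative (Submodule.span ℂ {WithLp.toLp 2 x, WithLp.toLp 2 c}) where
  finrank_eq := by
    have hlin : LinearIndependent ℂ ![WithLp.toLp 2 x, WithLp.toLp 2 c] := by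
      rw [LinearIndependent.pair_iff' (by simpa using hx)]
      intro p hp
      exact hli p (congrArg WithLp.ofLp hp).symm
    have := finrank_span_eq_card hlin
    rwa [Matrix.range_cons_cons_empty, Fintype.card_fin] at this
  isotropic u hu v hv := by
    obtain ⟨a, b, rfl⟩ := Submodule.mem_span_pair.mp hu
    obtain ⟨a', b', rfl⟩ := Submodule.mem_span_pair.mp hv
    simp [hxx, hxc, hcc, dotProduct_comm c x]
  imMul_eq_zero u hu v hv := by
    obtain ⟨a, b, rfl⟩ := Submodule.mem_span_pair.mp hu
    obtain ⟨a', b', rfl⟩ := Submodule.mem_span_pair.mp hv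
    simp [imMul_add, add_imMul, imMul_smul, smul_imMul, hm, imMul_eq_zero_comm hm]

/-! ### Leading coefficients at a pole -/

theorem toLp_mem_span_pair {x y w : Fin 7 → ℂ} :
    WithLp.toLp 2 w ∈ Submodule.span ℂ {(WithLp.toLp 2 x : C7), WithLp.toLp 2 y} ↔
      ∃ a b : ℂ, w = a • x + b • y := by
  rw [Submodule.mem_span_pair]
  constructor
  · rintro ⟨a, b, h⟩
    exact ⟨a, b, (congrArg WithLp.ofLp h).symm⟩
  · rintro ⟨a, b, rfl⟩
    exact ⟨a, b, by simp⟩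

/-- The relations between the two leading coefficients `A`, `D` at a pole of a loop in `G₂`, where
`q` is the derivative of the denominator. -/
structure IsPolePair (A D : Matrix (Fin 7) (Fin 7) ℂ) (q : ℂ) : Prop where
  imMul_eq : ∀ u v, imMul (A *ᵥ u) (A *ᵥ v) = 0
  dot_eq : ∀ u v, (A *ᵥ u) ⬝ᵥ (A *ᵥ v) = 0
  dot_add : ∀ u v, (D *ᵥ u) ⬝ᵥ (A *ᵥ v) + (A *ᵥ u) ⬝ᵥ (D *ᵥ v) = 0
  imMul_add : ∀ u v, imMul (D *ᵥ u) (A *ᵥ v) + imMul (A *ᵥ u) (D *ᵥ v) = q • A *ᵥ imMul u v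

/-- A single simple element lowers the order of the pole. -/
def IsReducing (W : Submodule ℂ C7) (A D : Matrix (Fin 7) (Fin 7) ℂ) : Prop :=
  (∀ u, WithLp.toLp 2 (A *ᵥ u) ∈ W) ∧ ∀ w, WithLp.toLp 2 w ∈ W → ∀ u, w ⬝ᵥ (D *ᵥ u) = 0

namespace IsPolePair

variable {A D : Matrix (Fin 7) (Fin 7) ℂ} {q : ℂ}

theorem dot_self (h : IsPolePair A D q) (u : Fin 7 → ℂ) : (A *ᵥ u) ⬝ᵥ (D *ᵥ u) = 0 := by
  have h1 := h.dot_add u u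
  rw [dotProduct_comm, ← two_mul] at h1
  simpa using h1

/-- With `A = x nᵀ`, the vectors `D z` for `z ⊥ n` turn out to lie in the isotropic annihilator of
`x`. A second vector `c` of that annihilator then only has to be orthogonal to the single vector `D
e`. -/
theorem exists_isReducing_of_rank_one (h : IsPolePair A D q) {e : Fin 7 → ℂ} (he : A *ᵥ e ≠ 0)
    (hr : ∀ u, ∃ c : ℂ, A *ᵥ u = c • A *ᵥ e) : ∃ W, IsComplexCoassociative W ∧
      IsReducing W A D := by
  set x := A *ᵥ e with hx
  have hxx : x ⬝ᵥ x = 0 := h.dot_eq e e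
  have hs := star_dotProduct_self_ne_zero he
  set n : Fin 7 → ℂ := (star x ⬝ᵥ x)⁻¹ • (star x ᵥ* A) with hn
  have hA : ∀ u, A *ᵥ u = (n ⬝ᵥ u) • x := by
    intro u
    obtain ⟨c, hc⟩ := hr u
    rw [hn, smul_dotProduct, ← Matrix.dotProduct_mulVec, hc, dotProduct_smul, smul_eq_mul,
      smul_eq_mul, mul_comm c, inv_mul_cancel_left₀ hs]
  have hne : n ⬝ᵥ e = 1 := by
    have h1 : (n ⬝ᵥ e - 1) • x = 0 := by
      rw [sub_smul, ← hA e, one_smul, ← hx, sub_self]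
    exact sub_eq_zero.mp ((smul_eq_zero.mp h1).resolve_right he)
  have hn0 : n ≠ 0 := fun h0 => by simp [h0] at hne
  -- Evaluate the product relation at `y, z` in the kernel of `n` with `⟨n, y·z⟩ ≠ 0`: the left side
  -- vanishes.
  have hq : q = 0 := by
    obtain ⟨y, z, hy, hz, hyz⟩ := exists_dotProduct_imMul_ne_zero hn0
    have h1 := h.imMul_add y z
    rw [hA y, hA z, hA (imMul y z), hy, hz, zero_smul, imMul_zero, zero_imMul, add_zero] at h1
    simpa [he, hyz] using h1.symm
  have hD : ∀ z, n ⬝ᵥ z = 0 → imMul x (D *ᵥ z) = 0 := by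
    intro z hz
    have h1 := h.imMul_add e z
    rwa [hA z, hz, zero_smul, imMul_zero, zero_add, hq, zero_smul] at h1
  have hdec : ∀ u, ∃ z, n ⬝ᵥ z = 0 ∧ u = z + (n ⬝ᵥ u) • e := fun u =>
    ⟨u - (n ⬝ᵥ u) • e, by simp [hne], by simp⟩
  -- The annihilator is three-dimensional, which leaves room for two linear conditions: hermitian
  -- orthogonality to `x`, for independence, and `⟨D e, c⟩ = 0`.
  obtain ⟨c, hc0, hxc, hc1, hc2⟩ := exists_mem_annihilator he hxx
    (dotProductBilin ℂ ℂ (star x)) (dotProductBilin ℂ ℂ (D *ᵥ e))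
  replace hc1 : star x ⬝ᵥ c = 0 := hc1
  replace hc2 : D *ᵥ e ⬝ᵥ c = 0 := hc2
  have hli : ∀ p : ℂ, c ≠ p • x := by
    rintro p rfl
    rw [dotProduct_smul, smul_eq_mul] at hc1
    exact hc0 (by rw [(mul_eq_zero.mp hc1).resolve_right hs, zero_smul])
  refine ⟨_, isComplexCoassociative_span he hxx
    (dotProduct_eq_zero_of_imMul_eq_zero he hxx hxc)
    (dotProduct_eq_zero_of_mem_annihilator he hxx hxc hxc) hxc hli, ?_, ?_⟩
  · intro u
    rw [toLp_mem_span_pair]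
    exact ⟨n ⬝ᵥ u, 0, by rw [hA u, zero_smul, add_zero]⟩
  · intro w hw u
    obtain ⟨a, b, rfl⟩ := toLp_mem_span_pair.mp hw
    obtain ⟨z, hz, hu⟩ := hdec u
    have h1 := dotProduct_eq_zero_of_imMul_eq_zero he hxx (hD z hz)
    have h2 := dotProduct_eq_zero_of_mem_annihilator he hxx hxc (hD z hz)
    have h3 : x ⬝ᵥ (D *ᵥ e) = 0 := h.dot_self e
    rw [hu, Matrix.mulVec_add, Matrix.mulVec_smul]
    simp only [add_dotProduct, dotProduct_add, smul_dotProduct, dotProduct_smul, h1, h2, h3,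
      dotProduct_comm c, hc2, smul_zero, add_zero]

theorem mem_span (h : IsPolePair A D q) {e f : Fin 7 → ℂ} (he : A *ᵥ e ≠ 0)
    (hli : ∀ p : ℂ, A *ᵥ f ≠ p • A *ᵥ e) (u : Fin 7 → ℂ) :
    ∃ a b : ℂ, A *ᵥ u = a • A *ᵥ e + b • A *ᵥ f :=
  mem_span_of_imMul_eq_zero he (h.dot_eq e e) (h.imMul_eq e f) (h.imMul_eq e u)
    (h.imMul_eq f u) hli

/-- The pairing of `A u` with `D v` descends to an alternating form on the two-dimensional image of
`A`. One nonzero vector in its radical makes it vanish, so the image itself serves as `W`. -/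
theorem exists_isReducing_of_rank_two (h : IsPolePair A D q) {e f : Fin 7 → ℂ} (he : A *ᵥ e ≠ 0)
    (hli : ∀ p : ℂ, A *ᵥ f ≠ p • A *ᵥ e) (h0 : ∀ u, (A *ᵥ e) ⬝ᵥ (D *ᵥ u) = 0) :
    ∃ W, IsComplexCoassociative W ∧ IsReducing W A D := by
  refine ⟨_, isComplexCoassociative_span he (h.dot_eq e e) (h.dot_eq e f) (h.dot_eq f f)
    (h.imMul_eq e f) hli, fun u => toLp_mem_span_pair.mpr (h.mem_span he hli u), ?_⟩
  intro w hw u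
  obtain ⟨a, b, rfl⟩ := toLp_mem_span_pair.mp hw
  obtain ⟨a', b', hu⟩ := h.mem_span he hli u
  have h1 : (A *ᵥ f) ⬝ᵥ (D *ᵥ u) = 0 := by
    have h2 := h.dot_add f u
    rw [hu, dotProduct_add, dotProduct_smul, dotProduct_smul, dotProduct_comm (D *ᵥ f) (A *ᵥ e),
      h0 f, dotProduct_comm (D *ᵥ f) (A *ᵥ f), h.dot_self f] at h2
    simpa using h2
  rw [add_dotProduct, smul_dotProduct, smul_dotProduct, h0, h1, smul_zero, smul_zero, add_zero]

theorem exists_isReducing_or (h : IsPolePair A D q) (hA : A ≠ 0) :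
    (∃ W, IsComplexCoassociative W ∧ IsReducing W A D) ∨
      ∃ e f, A *ᵥ e ≠ 0 ∧ (∀ p : ℂ, A *ᵥ f ≠ p • A *ᵥ e) ∧ star (A *ᵥ e) ⬝ᵥ (A *ᵥ f) = 0 := by
  have hex : ∃ e, A *ᵥ e ≠ 0 := by
    by_contra! h0
    exact hA (Matrix.ext_iff_mulVec.mpr fun v => by rw [h0 v, Matrix.zero_mulVec])
  obtain ⟨e, he⟩ := hex
  by_cases hr : ∀ u, ∃ c : ℂ, A *ᵥ u = c • A *ᵥ e
  · exact Or.inl (h.exists_isReducing_of_rank_one he hr)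
  · push Not at hr
    obtain ⟨f, hf⟩ := hr
    have hs := star_dotProduct_self_ne_zero he
    set c := (star (A *ᵥ e) ⬝ᵥ (A *ᵥ f)) / (star (A *ᵥ e) ⬝ᵥ (A *ᵥ e)) with hc
    refine Or.inr ⟨e, f - c • e, he, ?_, ?_⟩
    · intro p hp
      rw [Matrix.mulVec_sub, Matrix.mulVec_smul, sub_eq_iff_eq_add, ← add_smul] at hp
      exact hf _ hp
    · rw [Matrix.mulVec_sub, Matrix.mulVec_smul, dotProduct_sub, dotProduct_smul, smul_eq_mul, hc,
        div_mul_cancel₀ _ hs, sub_self]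

/-- Rank one is already settled. In rank two the image of `A` is all of the span of `z` and `y`, so
it contains `y`, which is the radical vector needed for the rank two case. -/
theorem exists_isReducing_of_mem_span (h : IsPolePair A D q) (hA : A ≠ 0) {y z : Fin 7 → ℂ}
    (hy : y ≠ 0) (hyD : ∀ u, y ⬝ᵥ (D *ᵥ u) = 0)
    (hspan : ∀ u, ∃ a b : ℂ, A *ᵥ u = a • z + b • y) :
    ∃ W, IsComplexCoassociative W ∧ IsReducing W A D := by
  obtain hW | ⟨e, f, he, hli, -⟩ := h.exists_isReducing_or hA
  · exact hW
  obtain ⟨a, b, hab⟩ := hspan e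
  obtain ⟨a', b', hab'⟩ := hspan f
  have hu : ∃ u, A *ᵥ u = y := by
    -- The determinant of `A e, A f` in terms of `z, y`: if zero, the two vectors are proportional;
    -- otherwise Cramer's rule produces a preimage of `y`.
    by_cases hdet : a' * b - a * b' = 0
    · exfalso
      by_cases ha : a = 0
      · have hb : b ≠ 0 := by
          rintro rfl
          exact he (by rw [hab, ha, zero_smul, zero_smul, add_zero])
        have ha' : a' = 0 := by simpa [ha, hb] using hdet
        apply hli (b' / b)
        rw [hab, hab', ha, ha', zero_smul, zero_add, zero_add, smul_smul, div_mul_cancel₀ _ hb]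
      · apply hli (a' / a)
        rw [hab, hab', smul_add, smul_smul, smul_smul, div_mul_cancel₀ _ ha]
        congr 2
        field_simp
        linear_combination -hdet
    · refine ⟨(a' * b - a * b')⁻¹ • (a' • e - a • f), ?_⟩
      rw [Matrix.mulVec_smul, Matrix.mulVec_sub, Matrix.mulVec_smul, Matrix.mulVec_smul, hab, hab']
      have : a' • (a • z + b • y) - a • (a' • z + b' • y) = (a' * b - a * b') • y := by module
      rw [this, smul_smul, inv_mul_cancel₀ hdet, one_smul]
  obtain ⟨u, rfl⟩ := hu
  have hv : ∃ v, ∀ p : ℂ, A *ᵥ v ≠ p • A *ᵥ u := by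
    by_contra! hc
    obtain ⟨p, hp⟩ := hc e
    obtain ⟨p', hp'⟩ := hc f
    have hp0 : p ≠ 0 := by
      rintro rfl
      exact he (by rw [hp, zero_smul])
    exact hli (p' / p) (by rw [hp, hp', smul_smul, div_mul_cancel₀ _ hp0])
  obtain ⟨v, hv⟩ := hv
  exact h.exists_isReducing_of_rank_two hy hv hyD

/-- Supplies the auxiliary plane `W` for rank two. The displayed combination of `D` and `A` is, for
`s = α - conj α`, the value at `α` of the new numerator; its image must lie in a plane containing a
vector `y` of `conj W` that is orthogonal to the image of `A`. -/
theorem exists_rotating (h : IsPolePair A D q) {e f : Fin 7 → ℂ} (he : A *ᵥ e ≠ 0)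
    (hli : ∀ p : ℂ, A *ᵥ f ≠ p • A *ᵥ e) (horth : star (A *ᵥ e) ⬝ᵥ (A *ᵥ f) = 0) (s : ℂ) :
    ∃ W, IsComplexCoassociative W ∧ (∀ w, WithLp.toLp 2 w ∈ W → ∀ u, w ⬝ᵥ (A *ᵥ u) = 0) ∧
      ∃ y z : Fin 7 → ℂ, y ≠ 0 ∧ WithLp.toLp 2 (star y) ∈ W ∧ (∀ u, y ⬝ᵥ (A *ᵥ u) = 0) ∧
        ∀ u, ∃ a b : ℂ, s • projMatrix (conjSubspace W) *ᵥ (D *ᵥ u)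
          + projMatrix (assocComplement W) *ᵥ (A *ᵥ u) = a • z + b • y := by
  have hspan := h.mem_span he hli
  have hxx := h.dot_eq e e
  have hxy := h.imMul_eq e f
  have hxD : ∀ u, (A *ᵥ e) ⬝ᵥ (D *ᵥ u) = -((D *ᵥ e) ⬝ᵥ (A *ᵥ u)) := fun u => by
    linear_combination h.dot_add e u
  have hDe : (D *ᵥ e) ⬝ᵥ (A *ᵥ e) = 0 := by rw [dotProduct_comm, h.dot_self]
  set x := A *ᵥ e with hx
  set y := A *ᵥ f with hy
  have hs := star_dotProduct_self_ne_zero he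
  -- Take `W` spanned by `x` and a `c` in the annihilator of `x`, hermitian orthogonal to both `x`
  -- and `y`. Then `star c` is `⟨,⟩`-orthogonal to the image of `A`, and `y` lies in the weight zero
  -- part.
  obtain ⟨c, hc0, hxc, hc1, hc2⟩ := exists_mem_annihilator he hxx
    (dotProductBilin ℂ ℂ (star x)) (dotProductBilin ℂ ℂ (star y))
  replace hc1 : star x ⬝ᵥ c = 0 := hc1
  replace hc2 : star y ⬝ᵥ c = 0 := hc2
  have hcs := star_dotProduct_self_ne_zero hc0
  have hcx : star c ⬝ᵥ x = 0 := by rw [Matrix.star_dotProduct, hc1, star_zero]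
  have hcy : star c ⬝ᵥ y = 0 := by rw [Matrix.star_dotProduct, hc2, star_zero]
  have hli' : ∀ p : ℂ, c ≠ p • x := by
    rintro p rfl
    rw [dotProduct_smul, smul_eq_mul] at hc1
    exact hc0 (by rw [(mul_eq_zero.mp hc1).resolve_right hs, zero_smul])
  have hW := isComplexCoassociative_span he hxx
    (dotProduct_eq_zero_of_imMul_eq_zero he hxx hxc)
    (dotProduct_eq_zero_of_mem_annihilator he hxx hxc hxc) hxc hli'
  set W := Submodule.span ℂ {(WithLp.toLp 2 x : C7), WithLp.toLp 2 c} with hWdef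
  have hxW : WithLp.toLp 2 x ∈ W := toLp_mem_span_pair.mpr ⟨1, 0, by simp⟩
  have hcW : WithLp.toLp 2 c ∈ W := toLp_mem_span_pair.mpr ⟨0, 1, by simp⟩
  have hWx : ∀ w, WithLp.toLp 2 w ∈ W → imMul x w = 0 := fun w hw => hW.imMul_eq_zero _ hxW _ hw
  have hyA : WithLp.toLp 2 y ∈ assocComplement W := by
    rw [toLp_mem_assocComplement]
    intro w hw
    refine ⟨dotProduct_eq_zero_of_mem_annihilator he hxx (hWx w hw) hxy, ?_⟩
    obtain ⟨a, b, rfl⟩ := toLp_mem_span_pair.mp hw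
    simp [add_dotProduct, horth, hcy]
  have hproj : ∀ v, projMatrix (conjSubspace W) *ᵥ v =
      ((x ⬝ᵥ v) / (star x ⬝ᵥ x)) • star x + ((c ⬝ᵥ v) / (star c ⬝ᵥ c)) • star c := by
    intro v
    set v' := ((x ⬝ᵥ v) / (star x ⬝ᵥ x)) • star x + ((c ⬝ᵥ v) / (star c ⬝ᵥ c)) • star c with hv'
    have hv'W : WithLp.toLp 2 v' ∈ conjSubspace W := by
      rw [toLp_mem_conjSubspace, toLp_mem_span_pair]
      exact ⟨_, _, by rw [hv', star_add, star_smul, star_smul, star_star, star_star]⟩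
    have h0 : projMatrix (conjSubspace W) *ᵥ (v - v') = 0 := by
      apply projMatrix_conj_mulVec
      intro w hw
      obtain ⟨a, b, rfl⟩ := toLp_mem_span_pair.mp hw
      have e1 : x ⬝ᵥ v' = x ⬝ᵥ v := by
        rw [hv', dotProduct_add, dotProduct_smul, dotProduct_smul, dotProduct_comm x (star c), hcx,
          smul_zero, add_zero, dotProduct_comm x (star x), smul_eq_mul, div_mul_cancel₀ _ hs]
      have e2 : c ⬝ᵥ v' = c ⬝ᵥ v := by
        rw [hv', dotProduct_add, dotProduct_smul, dotProduct_smul, dotProduct_comm c (star x), hc1,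
          smul_zero, zero_add, dotProduct_comm c (star c), smul_eq_mul, div_mul_cancel₀ _ hcs]
      simp [add_dotProduct, dotProduct_sub, e1, e2]
    rw [Matrix.mulVec_sub, projMatrix_mulVec_of_mem hv'W] at h0
    exact sub_eq_zero.mp h0
  -- If `A u = a x + b y`, then `⟨x, D u⟩ = -b ⟨D e, y⟩`. So the `star x` and `y` components occur
  -- in a fixed ratio, which is the second vector; only the `star c` coefficient is free.
  refine ⟨W, hW, ?_, star c, y - (s * ((D *ᵥ e) ⬝ᵥ y) / (star x ⬝ᵥ x)) • star x, ?_, ?_, ?_, ?_⟩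
  · intro w hw u
    exact dotProduct_eq_zero_of_mem_annihilator he hxx (hWx w hw) (h.imMul_eq e u)
  · simpa using hc0
  · rwa [star_star]
  · intro u
    obtain ⟨a, b, hab⟩ := hspan u
    simp [hab, hcx, hcy]
  · intro u
    obtain ⟨a, b, hab⟩ := hspan u
    refine ⟨b, s * ((c ⬝ᵥ (D *ᵥ u)) / (star c ⬝ᵥ c)), ?_⟩
    rw [hproj, hxD, hab, Matrix.mulVec_add, Matrix.mulVec_smul, Matrix.mulVec_smul,
      projMatrix_assoc_mulVec hxW, projMatrix_mulVec_of_mem hyA, dotProduct_add, dotProduct_smul,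
      dotProduct_smul, hDe, smul_eq_mul, smul_eq_mul]
    module

end IsPolePair

/-! ### Loops with prescribed denominators -/

/-- The polynomial `∏ (z - a) (z - conj a)`, where `a` runs through the list `l`. -/
noncomputable def conjPoleProd (l : List ℂ) (z : ℂ) : ℂ :=
  (l.map fun a => (z - a) * (z - starRingEnd ℂ a)).prod

@[simp] theorem conjPoleProd_nil (z : ℂ) : conjPoleProd [] z = 1 := rfl

@[simp] theorem conjPoleProd_cons (a : ℂ) (l : List ℂ) (z : ℂ) :
    conjPoleProd (a :: l) z = (z - a) * (z - starRingEnd ℂ a) * conjPoleProd l z := by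
  simp [conjPoleProd]

theorem differentiable_conjPoleProd (l : List ℂ) : Differentiable ℂ (conjPoleProd l) := by
  induction l with
  | nil => exact differentiable_const 1
  | cons a l ih =>
    have : conjPoleProd (a :: l) =
        fun z => (z - a) * (z - starRingEnd ℂ a) * conjPoleProd l z := by
      ext z; simp
    rw [this]
    fun_prop

theorem conjPoleProd_conj (l : List ℂ) (z : ℂ) :
    starRingEnd ℂ (conjPoleProd l (starRingEnd ℂ z)) = conjPoleProd l z := by
  induction l with
  | nil => simp
  | cons a l ih =>
    simp only [conjPoleProd_cons, map_mul, map_sub, Complex.conj_conj, ih]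
    ring

theorem finite_conjPoleProd_eq_zero (l : List ℂ) : {z | conjPoleProd l z = 0}.Finite := by
  induction l with
  | nil => simp
  | cons a l ih =>
    refine (ih.union ((Set.finite_singleton a).union
      (Set.finite_singleton (starRingEnd ℂ a)))).subset ?_
    intro z hz
    simp only [conjPoleProd_cons, Set.mem_ofPred_eq, mul_eq_zero, sub_eq_zero] at hz
    simp only [Set.mem_union, Set.mem_ofPred_eq, Set.mem_singleton_iff]
    tauto

theorem dense_compl_of_finite {S : Set ℂ} (hS : S.Finite) : Dense Sᶜ := by
  rw [Set.compl_eq_univ_sdiff]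
  exact dense_univ.sdiff_finite hS

theorem dense_preimage_conj {T : Set ℂ} (hT : Dense T) : Dense (starRingEnd ℂ ⁻¹' T) :=
  hT.preimage Complex.conjLIE.toHomeomorph.isOpenMap

theorem eventually_cocompact_notMem {S : Set ℂ} (hS : S.Finite) :
    ∀ᶠ z in cocompact ℂ, z ∉ S := hS.isCompact.compl_mem_cocompact

/-- `H` is the numerator of a real loop in `G₂` with denominator `conjPoleProd l`. -/
structure IsLoopNumerator (l : List ℂ) (H : ℂ → Matrix (Fin 7) (Fin 7) ℂ) : Prop where
  differentiable : ∀ i j, Differentiable ℂ fun z => H z i j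
  dot_eq : ∀ z u v, (H z *ᵥ u) ⬝ᵥ (H z *ᵥ v) = conjPoleProd l z ^ 2 * (u ⬝ᵥ v)
  imMul_eq : ∀ z u v, imMul (H z *ᵥ u) (H z *ᵥ v) = conjPoleProd l z • H z *ᵥ imMul u v
  map_conj : ∀ z, (H (starRingEnd ℂ z)).map (starRingEnd ℂ) = H z
  tendsto : Tendsto (fun z => (conjPoleProd l z)⁻¹ • H z) (cocompact ℂ) (𝓝 1)

theorem continuous_of_differentiable_entries {H : ℂ → Matrix (Fin 7) (Fin 7) ℂ}
    (h : ∀ i j, Differentiable ℂ fun z => H z i j) : Continuous H :=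
  continuous_matrix fun i j => (h i j).continuous

theorem continuous_imMul {f g : ℂ → Fin 7 → ℂ} (hf : Continuous f) (hg : Continuous g) :
    Continuous fun z => imMul (f z) (g z) := by
  rw [continuous_pi_iff] at *
  intro i
  fin_cases i <;> simp only [imMul] <;> fun_prop

/-- Written without denominators, the group and reality relations are equalities of continuous
functions, so they extend from a dense set to the poles. That is where they will be used. -/
theorem IsLoopNumerator.of_dense {l : List ℂ} {H : ℂ → Matrix (Fin 7) (Fin 7) ℂ}
    (hd : ∀ i j, Differentiable ℂ fun z => H z i j)
    {F : ℂ → Matrix (Fin 7) (Fin 7) ℂ} {T : Set ℂ} (hTo : IsOpen T) (hT : Dense T)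
    (hHF : ∀ z ∈ T, H z = conjPoleProd l z • F z)
    (hdot : ∀ z ∈ T, ∀ u v, (F z *ᵥ u) ⬝ᵥ (F z *ᵥ v) = u ⬝ᵥ v)
    (hmul : ∀ z ∈ T, ∀ u v, F z *ᵥ imMul u v = imMul (F z *ᵥ u) (F z *ᵥ v))
    (hconj : ∀ z ∈ T, (F (starRingEnd ℂ z)).map (starRingEnd ℂ) = F z)
    (hlim : Tendsto (fun z => (conjPoleProd l z)⁻¹ • H z) (cocompact ℂ) (𝓝 1)) :
    IsLoopNumerator l H := by
  have hH := continuous_of_differentiable_entries hd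
  have hQ := (differentiable_conjPoleProd l).continuous
  have hHu : ∀ u, Continuous fun z => H z *ᵥ u := fun u => hH.matrix_mulVec continuous_const
  refine ⟨hd, ?_, ?_, ?_, hlim⟩
  · intro z u v
    refine congrFun (Continuous.ext_on hT (f := fun z => (H z *ᵥ u) ⬝ᵥ (H z *ᵥ v))
      (g := fun z => conjPoleProd l z ^ 2 * (u ⬝ᵥ v)) ((hHu u).dotProduct (hHu v))
      ((hQ.pow 2).mul continuous_const) ?_) z
    intro w hw
    simp only [hHF w hw, Matrix.smul_mulVec, smul_dotProduct, dotProduct_smul, hdot w hw,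
      smul_eq_mul]
    ring
  · intro z u v
    refine congrFun (Continuous.ext_on hT (f := fun z => imMul (H z *ᵥ u) (H z *ᵥ v))
      (g := fun z => conjPoleProd l z • H z *ᵥ imMul u v) (continuous_imMul (hHu u) (hHu v))
      (hQ.smul (hHu _)) ?_) z
    intro w hw
    simp only [hHF w hw, Matrix.smul_mulVec, imMul_smul, smul_imMul, hmul w hw]
  · intro z
    have hT' : Dense (T ∩ starRingEnd ℂ ⁻¹' T) :=
      hT.inter_of_isOpen_left (dense_preimage_conj hT) hTo
    refine congrFun (Continuous.ext_on hT'
      (f := fun z => (H (starRingEnd ℂ z)).map (starRingEnd ℂ)) (g := H)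
      ((hH.comp Complex.continuous_conj).matrix_map Complex.continuous_conj) hH ?_) z
    intro w hw
    simp only [hHF w hw.1, hHF _ hw.2]
    rw [← hconj w hw.1, ← conjPoleProd_conj l w]
    ext i j
    simp

theorem IsLoopNumerator.of_finite {l : List ℂ} {H : ℂ → Matrix (Fin 7) (Fin 7) ℂ}
    (hd : ∀ i j, Differentiable ℂ fun z => H z i j)
    {F : ℂ → Matrix (Fin 7) (Fin 7) ℂ} {S : Set ℂ} (hS : S.Finite)
    (hHF : ∀ z ∉ S, H z = conjPoleProd l z • F z)
    (hdot : ∀ z ∉ S, ∀ u v, (F z *ᵥ u) ⬝ᵥ (F z *ᵥ v) = u ⬝ᵥ v)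
    (hmul : ∀ z ∉ S, ∀ u v, F z *ᵥ imMul u v = imMul (F z *ᵥ u) (F z *ᵥ v))
    (hconj : ∀ z ∉ S, (F (starRingEnd ℂ z)).map (starRingEnd ℂ) = F z)
    (hlim : Tendsto F (cocompact ℂ) (𝓝 1)) : IsLoopNumerator l H := by
  refine IsLoopNumerator.of_dense hd hS.isClosed.isOpen_compl (dense_compl_of_finite hS) hHF hdot
    hmul hconj (hlim.congr' ?_)
  filter_upwards [eventually_cocompact_notMem hS,
    eventually_cocompact_notMem (finite_conjPoleProd_eq_zero l)] with z hz hz0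
  rw [hHF z hz, smul_smul, inv_mul_cancel₀ hz0, one_smul]

section

variable {l : List ℂ} {H : ℂ → Matrix (Fin 7) (Fin 7) ℂ} {z : ℂ}

/-- The value of the loop with numerator `H`. -/
noncomputable def loopValue (l : List ℂ) (H : ℂ → Matrix (Fin 7) (Fin 7) ℂ) (z : ℂ) :
    Matrix (Fin 7) (Fin 7) ℂ := (conjPoleProd l z)⁻¹ • H z

theorem IsLoopNumerator.loopValue_dot (h : IsLoopNumerator l H) (hz : conjPoleProd l z ≠ 0)
    (u v : Fin 7 → ℂ) : (loopValue l H z *ᵥ u) ⬝ᵥ (loopValue l H z *ᵥ v) = u ⬝ᵥ v := by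
  simp only [loopValue, Matrix.smul_mulVec, smul_dotProduct, dotProduct_smul, h.dot_eq, smul_eq_mul]
  field_simp

theorem IsLoopNumerator.loopValue_imMul (h : IsLoopNumerator l H) (hz : conjPoleProd l z ≠ 0)
    (u v : Fin 7 → ℂ) :
    loopValue l H z *ᵥ imMul u v = imMul (loopValue l H z *ᵥ u) (loopValue l H z *ᵥ v) := by
  simp only [loopValue, Matrix.smul_mulVec, smul_imMul, imMul_smul, h.imMul_eq, smul_smul]
  rw [inv_mul_cancel₀ hz, mul_one]

theorem IsLoopNumerator.loopValue_conj (h : IsLoopNumerator l H) (z : ℂ) :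
    (loopValue l H (starRingEnd ℂ z)).map (starRingEnd ℂ) = loopValue l H z := by
  simp only [loopValue]
  rw [← h.map_conj z, ← conjPoleProd_conj l z]
  ext i j
  simp

theorem isUnit_of_dot {A : Matrix (Fin 7) (Fin 7) ℂ}
    (h : ∀ u v, (A *ᵥ u) ⬝ᵥ (A *ᵥ v) = u ⬝ᵥ v) : IsUnit A := by
  rw [← Matrix.mulVec_injective_iff_isUnit]
  intro u v huv
  rw [← sub_eq_zero]
  apply dotProduct_eq_zero
  intro w
  rw [← h, Matrix.mulVec_sub]
  have : A *ᵥ u = A *ᵥ v := huv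
  rw [this, sub_self, zero_dotProduct]

end

/-! ### Germs of loops -/

open Classical in
/-- An invertible matrix as an element of `GL`, with junk value `1`. -/
noncomputable def matrixToGL {n : ℕ} (A : Matrix (Fin n) (Fin n) ℂ) : GL (Fin n) ℂ :=
  if h : IsUnit A then h.unit else 1

theorem coe_matrixToGL {n : ℕ} {A : Matrix (Fin n) (Fin n) ℂ} (h : IsUnit A) :
    (matrixToGL A : Matrix (Fin n) (Fin n) ℂ) = A := by
  rw [matrixToGL, dif_pos h, IsUnit.unit_spec]

/-- The map to `GL` with the given values at finite points and the value `1` at `∞`. -/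
noncomputable def extendToGL {n : ℕ} (F : ℂ → Matrix (Fin n) (Fin n) ℂ) : OnePoint ℂ → GL (Fin n) ℂ
  | ∞ => 1
  | (z : ℂ) => matrixToGL (F z)

theorem extendToGL_coe {n : ℕ} (F : ℂ → Matrix (Fin n) (Fin n) ℂ) (z : ℂ) :
    extendToGL F (z : OnePoint ℂ) = matrixToGL (F z) := rfl

theorem eventually_denseOpen_of_dense {T : Set ℂ} (hTo : IsOpen T) (hT : Dense T)
    {P : OnePoint ℂ → Prop} (h : ∀ z ∈ T, P (z : OnePoint ℂ)) :
    ∀ᶠ p in denseOpen (OnePoint ℂ), P p := by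
  refine ⟨(fun z : ℂ => (z : OnePoint ℂ)) '' T, OnePoint.isOpenEmbedding_coe.isOpenMap _ hTo,
    OnePoint.denseRange_coe.dense_image OnePoint.continuous_coe hT, ?_⟩
  rintro _ ⟨z, hz, rfl⟩
  exact h z hz

theorem eventually_denseOpen_of_finite {S : Set ℂ} (hS : S.Finite) {P : OnePoint ℂ → Prop}
    (h : ∀ z ∉ S, P (z : OnePoint ℂ)) : ∀ᶠ p in denseOpen (OnePoint ℂ), P p :=
  eventually_denseOpen_of_dense hS.isClosed.isOpen_compl (dense_compl_of_finite hS) h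

/-- The loop with numerator `H`. -/
noncomputable def numeratorGerm (l : List ℂ) (H : ℂ → Matrix (Fin 7) (Fin 7) ℂ) : LoopGerm 7 :=
  (extendToGL (loopValue l H) : OnePoint ℂ → GL (Fin 7) ℂ)

/-- The value of the simple element `p_{α,W}` at a finite point. -/
noncomputable def simpleValue (α : ℂ) (W : Submodule ℂ C7) (z : ℂ) : Matrix (Fin 7) (Fin 7) ℂ :=
  simpleMatrix W ((z - α) / (z - starRingEnd ℂ α))

theorem finite_pair_conj (α : ℂ) : ({α, starRingEnd ℂ α} : Set ℂ).Finite := Set.toFinite _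

theorem blaschke_coe (α z : ℂ) :
    blaschke α (z : OnePoint ℂ) = (z - α) / (z - starRingEnd ℂ α) := rfl

theorem blaschke_ne_zero {α z : ℂ} (hz : z ∉ ({α, starRingEnd ℂ α} : Set ℂ)) :
    (z - α) / (z - starRingEnd ℂ α) ≠ 0 := by
  simp only [Set.mem_insert_iff, Set.mem_singleton_iff, not_or] at hz
  exact div_ne_zero (sub_ne_zero.mpr hz.1) (sub_ne_zero.mpr hz.2)

theorem simpleElement_mul_numeratorGerm {l l' : List ℂ} {H H' : ℂ → Matrix (Fin 7) (Fin 7) ℂ}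
    (h : IsLoopNumerator l H) {α : ℂ} {W : Submodule ℂ C7} (hW : IsComplexCoassociative W)
    {S : Set ℂ} (hS : S.Finite)
    (hval : ∀ z ∉ S, loopValue l' H' z = simpleValue α W z * loopValue l H z) :
    numeratorGerm l' H' = simpleElement α W hW * numeratorGerm l H := by
  rw [numeratorGerm, simpleElement, numeratorGerm, ← Germ.coe_mul, Germ.coe_eq]
  refine eventually_denseOpen_of_finite
    ((hS.union (finite_pair_conj α)).union (finite_conjPoleProd_eq_zero l)) ?_
  intro z hz
  simp only [Set.mem_union, not_or] at hz
  obtain ⟨⟨hzS, hzα⟩, hzQ⟩ := hz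
  have hb := blaschke_ne_zero hzα
  have hu := isUnit_of_dot (h.loopValue_dot hzQ)
  have hs : IsUnit (simpleValue α W z) := isUnit_of_dot (hW.simpleMatrix_dotProduct hb)
  rw [Pi.mul_apply, dif_pos (by rwa [blaschke_coe]), extendToGL_coe, extendToGL_coe]
  apply Units.ext
  rw [coe_matrixToGL (by rw [hval z hzS]; exact hs.mul hu), Units.val_mul, coe_matrixToGL hu,
    hval z hzS]
  rfl

theorem numeratorGerm_congr {l l' : List ℂ} {H H' : ℂ → Matrix (Fin 7) (Fin 7) ℂ}
    {S : Set ℂ} (hS : S.Finite) (hval : ∀ z ∉ S, loopValue l' H' z = loopValue l H z) :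
    numeratorGerm l' H' = numeratorGerm l H := by
  rw [numeratorGerm, numeratorGerm, Germ.coe_eq]
  refine eventually_denseOpen_of_finite hS fun z hz => ?_
  rw [extendToGL_coe, extendToGL_coe, hval z hz]

/-! ### Simple elements as loops -/

theorem projMatrix_mulVec_eq {W : Submodule ℂ C7} {v s : Fin 7 → ℂ} (hs : WithLp.toLp 2 s ∈ W)
    (h : ∀ w, WithLp.toLp 2 w ∈ W → star w ⬝ᵥ (v - s) = 0) : projMatrix W *ᵥ v = s := by
  have h0 := projMatrix_mulVec_eq_zero h
  rw [Matrix.mulVec_sub, projMatrix_mulVec_of_mem hs] at h0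
  exact sub_eq_zero.mp h0

theorem star_dotProduct_sub_projMatrix {W : Submodule ℂ C7} (v : Fin 7 → ℂ) {w : Fin 7 → ℂ}
    (hw : WithLp.toLp 2 w ∈ W) : star w ⬝ᵥ (v - projMatrix W *ᵥ v) = 0 := by
  have h := W.starProjection_inner_eq_zero (WithLp.toLp 2 v) _ hw
  rw [EuclideanSpace.inner_eq_star_dotProduct] at h
  rw [Matrix.star_dotProduct, dotProduct_comm, projMatrix_mulVec, star_eq_zero]
  exact h

theorem map_conj_mulVec (A : Matrix (Fin 7) (Fin 7) ℂ) (v : Fin 7 → ℂ) :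
    A.map (starRingEnd ℂ) *ᵥ v = star (A *ᵥ star v) := by
  ext i
  simp [Matrix.mulVec, dotProduct]

theorem projMatrix_map_conj (W : Submodule ℂ C7) :
    (projMatrix W).map (starRingEnd ℂ) = projMatrix (conjSubspace W) := by
  refine Matrix.ext_iff_mulVec.mpr fun v => ?_
  rw [map_conj_mulVec]
  refine (projMatrix_mulVec_eq ?_ ?_).symm
  · rw [toLp_mem_conjSubspace, star_star]
    exact projMatrix_mulVec_mem W _
  · intro w hw
    have h := star_dotProduct_sub_projMatrix (star v) (toLp_mem_conjSubspace.mp hw)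
    rw [← star_eq_zero, ← h, Matrix.star_dotProduct, star_star, star_star, star_sub, star_star,
      dotProduct_comm]

theorem conjSubspace_conjSubspace (W : Submodule ℂ C7) : conjSubspace (conjSubspace W) = W := by
  ext x
  change WithLp.toLp 2 (star (star x.ofLp)) ∈ W ↔ x ∈ W
  rw [star_star]

theorem conjSubspace_assocComplement (W : Submodule ℂ C7) :
    conjSubspace (assocComplement W) = assocComplement W := by
  ext x
  constructor
  · intro h
    have := star_mem_assocComplement h
    rwa [star_star] at this
  · exact fun h => star_mem_assocComplement h

theorem simpleValue_map_conj (α : ℂ) (W : Submodule ℂ C7) (z : ℂ) :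
    (simpleValue α W (starRingEnd ℂ z)).map (starRingEnd ℂ) = simpleValue α W z := by
  have h1 := projMatrix_map_conj W
  have h2 := projMatrix_map_conj (conjSubspace W)
  have h3 := projMatrix_map_conj (assocComplement W)
  rw [conjSubspace_conjSubspace] at h2
  rw [conjSubspace_assocComplement] at h3
  ext i j
  have e1 := congrFun (congrFun h1 i) j
  have e2 := congrFun (congrFun h2 i) j
  have e3 := congrFun (congrFun h3 i) j
  rw [Matrix.map_apply] at e1 e2 e3
  simp only [simpleValue, simpleMatrix, Matrix.map_apply, Matrix.add_apply, Matrix.smul_apply,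
    smul_eq_mul, map_add, map_mul, map_div₀, map_sub, Complex.conj_conj, inv_div, e1, e2,
    e3]
  ring

theorem simpleMatrix_one {W : Submodule ℂ C7} (hW : IsComplexCoassociative W) :
    simpleMatrix W 1 = 1 := by
  rw [simpleMatrix, inv_one, one_smul, one_smul, hW.projMatrix_add]

theorem tendsto_simpleValue (α : ℂ) {W : Submodule ℂ C7} (hW : IsComplexCoassociative W) :
    Tendsto (simpleValue α W) (cocompact ℂ) (𝓝 1) := by
  have h1 : Tendsto (fun z : ℂ => (z - α) / (z - starRingEnd ℂ α)) (cocompact ℂ) (𝓝 1) := by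
    have h2 : Tendsto (fun z : ℂ => 1 + (starRingEnd ℂ α - α) * (z - starRingEnd ℂ α)⁻¹)
        (cocompact ℂ) (𝓝 (1 + (starRingEnd ℂ α - α) * 0)) := by
      refine tendsto_const_nhds.add (tendsto_const_nhds.mul ?_)
      refine (tendsto_inv₀_cobounded (α := ℂ)).comp ?_
      rw [← Metric.cobounded_eq_cocompact]
      exact tendsto_sub_const_cobounded (starRingEnd ℂ α)
    rw [mul_zero, add_zero] at h2
    refine h2.congr' ?_
    filter_upwards [eventually_cocompact_notMem (Set.finite_singleton (starRingEnd ℂ α))] with z hz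
    have : z - starRingEnd ℂ α ≠ 0 := sub_ne_zero.mpr hz
    field_simp
    ring
  have h3 : ContinuousAt (simpleMatrix W) 1 := by
    unfold simpleMatrix
    refine ContinuousAt.add (ContinuousAt.add ?_ continuousAt_const) ?_
    · exact (continuousAt_inv₀ one_ne_zero).smul continuousAt_const
    · exact continuousAt_id.smul continuousAt_const
  have h4 := h3.tendsto.comp h1
  rwa [simpleMatrix_one hW] at h4

/-- Reduces multiplication by a simple element to divisibility: once the product with the new
denominator extends to an entire function, all other requirements on a numerator are automatic. -/
theorem IsLoopNumerator.simple_mul {l l' : List ℂ} {H H' : ℂ → Matrix (Fin 7) (Fin 7) ℂ}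
    (h : IsLoopNumerator l H) {α : ℂ} {W : Submodule ℂ C7} (hW : IsComplexCoassociative W)
    (hd : ∀ i j, Differentiable ℂ fun z => H' z i j)
    {S : Set ℂ} (hS : S.Finite)
    (hH : ∀ z ∉ S, H' z = conjPoleProd l' z • (simpleValue α W z * loopValue l H z)) :
    IsLoopNumerator l' H' ∧ numeratorGerm l' H' = simpleElement α W hW * numeratorGerm l H := by
  have hT := (hS.union (finite_pair_conj α)).union (finite_conjPoleProd_eq_zero l)
  constructor
  · refine IsLoopNumerator.of_finite (F := fun z => simpleValue α W z * loopValue l H z) hd hT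
      ?_ ?_ ?_ ?_ ?_
    · intro z hz
      exact hH z fun hzS => hz (Or.inl (Or.inl hzS))
    · intro z hz u v
      rw [← Matrix.mulVec_mulVec, ← Matrix.mulVec_mulVec]
      simp only [Set.mem_union, not_or] at hz
      rw [simpleValue, hW.simpleMatrix_dotProduct (blaschke_ne_zero hz.1.2), h.loopValue_dot hz.2]
    · intro z hz u v
      simp only [← Matrix.mulVec_mulVec]
      simp only [Set.mem_union, not_or] at hz
      rw [h.loopValue_imMul hz.2, simpleValue, hW.simpleMatrix_imMul (blaschke_ne_zero hz.1.2)]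
    · intro z _
      rw [Matrix.map_mul, simpleValue_map_conj, h.loopValue_conj]
    · have := (tendsto_simpleValue α hW).mul h.tendsto
      rwa [one_mul] at this
  · refine simpleElement_mul_numeratorGerm h hW (hS.union (finite_conjPoleProd_eq_zero l')) ?_
    intro z hz
    simp only [Set.mem_union, not_or] at hz
    rw [loopValue, hH z hz.1, smul_smul, inv_mul_cancel₀ hz.2, one_smul]

/-! ### Entire matrix functions -/

/-- The entrywise derivative of a matrix function. -/
noncomputable def matrixDeriv (H : ℂ → Matrix (Fin 7) (Fin 7) ℂ) (a : ℂ) :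
    Matrix (Fin 7) (Fin 7) ℂ := Matrix.of fun i j => deriv (fun z => H z i j) a

theorem hasDerivAt_mulVec {H : ℂ → Matrix (Fin 7) (Fin 7) ℂ}
    (hd : ∀ i j, Differentiable ℂ fun z => H z i j) (a : ℂ) (u : Fin 7 → ℂ) :
    HasDerivAt (fun z => H z *ᵥ u) (matrixDeriv H a *ᵥ u) a := by
  rw [hasDerivAt_pi]
  intro i
  simp only [Matrix.mulVec, dotProduct]
  exact HasDerivAt.fun_sum fun j _ => ((hd i j a).hasDerivAt).mul_const (u j)

theorem HasDerivAt.dotProduct_fun {f g : ℂ → Fin 7 → ℂ} {f' g' : Fin 7 → ℂ} {a : ℂ}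
    (hf : HasDerivAt f f' a) (hg : HasDerivAt g g' a) :
    HasDerivAt (fun z => f z ⬝ᵥ g z) (f' ⬝ᵥ g a + f a ⬝ᵥ g') a := by
  rw [hasDerivAt_pi] at hf hg
  simp only [dotProduct, ← Finset.sum_add_distrib]
  exact HasDerivAt.fun_sum fun i _ => (hf i).mul (hg i)

theorem HasDerivAt.imMul {f g : ℂ → Fin 7 → ℂ} {f' g' : Fin 7 → ℂ} {a : ℂ}
    (hf : HasDerivAt f f' a) (hg : HasDerivAt g g' a) :
    HasDerivAt (fun z => imMul (f z) (g z)) (_root_.imMul f' (g a) + _root_.imMul (f a) g') a := by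
  rw [hasDerivAt_pi] at hf hg ⊢
  -- All seven coordinates of the product have this shape, so one derivative with free indices
  -- serves for each of them.
  have h : ∀ i j k m n p : Fin 7, ∀ i' j' k' m' n' p' : Fin 7, HasDerivAt
      (fun z => (f z i * g z j - f z i' * g z j') + (f z k * g z m - f z k' * g z m')
        + (f z n * g z p - f z n' * g z p'))
      (((f' i * g a j + f a i * g' j) - (f' i' * g a j' + f a i' * g' j'))
        + ((f' k * g a m + f a k * g' m) - (f' k' * g a m' + f a k' * g' m'))
        + ((f' n * g a p + f a n * g' p) - (f' n' * g a p' + f a n' * g' p'))) a :=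
    fun i j k m n p i' j' k' m' n' p' =>
      ((((hf i).mul (hg j)).sub ((hf i').mul (hg j'))).add
        (((hf k).mul (hg m)).sub ((hf k').mul (hg m')))).add
        (((hf n).mul (hg p)).sub ((hf n').mul (hg p')))
  intro i
  fin_cases i
  all_goals
    refine (h _ _ _ _ _ _ _ _ _ _ _ _).congr_deriv ?_
    simp only [_root_.imMul, Pi.add_apply, Matrix.cons_val, Fin.reduceFinMk]
    ring

theorem exists_eq_sub_smul {K : ℂ → Matrix (Fin 7) (Fin 7) ℂ}
    (hd : ∀ i j, Differentiable ℂ fun z => K z i j) {a : ℂ} (ha : K a = 0) :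
    ∃ K' : ℂ → Matrix (Fin 7) (Fin 7) ℂ, (∀ i j, Differentiable ℂ fun z => K' z i j) ∧
      (∀ z, K z = (z - a) • K' z) ∧ K' a = matrixDeriv K a := by
  refine ⟨fun z => Matrix.of fun i j => dslope (fun z => K z i j) a z, ?_, ?_, ?_⟩
  · intro i j
    have := (Complex.differentiableOn_dslope (f := fun z => K z i j) (c := a)
      Filter.univ_mem).mpr (hd i j).differentiableOn
    exact differentiableOn_univ.mp this
  · intro z
    ext i j
    have := sub_smul_dslope (fun z => K z i j) a z
    rw [ha, Matrix.zero_apply, sub_zero] at this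
    exact this.symm
  · ext i j
    simp [matrixDeriv, dslope_same]

theorem differentiable_mul_left (P : Matrix (Fin 7) (Fin 7) ℂ) {H : ℂ → Matrix (Fin 7) (Fin 7) ℂ}
    (hd : ∀ i j, Differentiable ℂ fun z => H z i j) (i j : Fin 7) :
    Differentiable ℂ fun z => (P * H z) i j := by
  simp only [Matrix.mul_apply]
  exact Differentiable.fun_sum fun k _ => (hd k j).const_mul _

theorem matrixDeriv_mul_left (P : Matrix (Fin 7) (Fin 7) ℂ) {H : ℂ → Matrix (Fin 7) (Fin 7) ℂ}
    (hd : ∀ i j, Differentiable ℂ fun z => H z i j) (a : ℂ) :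
    matrixDeriv (fun z => P * H z) a = P * matrixDeriv H a := by
  ext i j
  simp only [matrixDeriv, Matrix.of_apply, Matrix.mul_apply]
  rw [deriv_fun_sum fun k _ => ((hd k j).const_mul _) a]
  exact Finset.sum_congr rfl fun k _ => deriv_const_mul _ (hd k j a)

theorem differentiable_conj_conj {K : ℂ → Matrix (Fin 7) (Fin 7) ℂ}
    (hd : ∀ i j, Differentiable ℂ fun z => K z i j) (i j : Fin 7) :
    Differentiable ℂ fun z => (K (starRingEnd ℂ z)).map (starRingEnd ℂ) i j := by
  intro z
  have := (hd i j (starRingEnd ℂ z)).conj_conj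
  rw [Complex.conj_conj] at this
  exact this

/-- These are the relations for `H` and their first derivatives at a root of `Q`. The form relation
carries `Q²`, whose derivative vanishes there; the product relation carries only `Q`, which leaves
the term with `q`. -/
theorem IsLoopNumerator.isPolePair {l : List ℂ} {H : ℂ → Matrix (Fin 7) (Fin 7) ℂ}
    (h : IsLoopNumerator l H) {a : ℂ} (ha : conjPoleProd l a = 0) :
    IsPolePair (H a) (matrixDeriv H a) (deriv (conjPoleProd l) a) := by
  have hH := hasDerivAt_mulVec h.differentiable a
  have hQ := (differentiable_conjPoleProd l a).hasDerivAt
  refine ⟨fun u v => ?_, fun u v => ?_, fun u v => ?_, fun u v => ?_⟩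
  · rw [h.imMul_eq, ha, zero_smul]
  · rw [h.dot_eq, ha]
    simp
  · have h1 := (hH u).dotProduct_fun (hH v)
    simp only [h.dot_eq] at h1
    have h2 := (hQ.pow 2).mul_const (u ⬝ᵥ v)
    rw [h1.unique h2, ha]
    simp
  · have h1 := (hH u).imMul (hH v)
    simp only [h.imMul_eq] at h1
    have h2 := hQ.smul (hH (_root_.imMul u v))
    rw [h1.unique h2, ha, zero_smul, zero_add]

/-! ### Lowering the order of a pole -/

theorem sub_conj_ne_zero {α : ℂ} (hα : α.im ≠ 0) : α - starRingEnd ℂ α ≠ 0 := by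
  intro h
  exact hα (Complex.conj_eq_iff_im.mp (sub_eq_zero.mp h).symm)

theorem simpleValue_mul_apply (α : ℂ) (W : Submodule ℂ C7) (z : ℂ)
    (A : Matrix (Fin 7) (Fin 7) ℂ) (i j : Fin 7) :
    (simpleValue α W z * A) i j =
      ((z - starRingEnd ℂ α) / (z - α)) * (projMatrix (conjSubspace W) * A) i j
        + (projMatrix (assocComplement W) * A) i j
        + ((z - α) / (z - starRingEnd ℂ α)) * (projMatrix W * A) i j := by
  rw [simpleValue, simpleMatrix, add_mul, add_mul, smul_mul_assoc, smul_mul_assoc, inv_div]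
  rfl

namespace IsLoopNumerator

variable {l : List ℂ} {H : ℂ → Matrix (Fin 7) (Fin 7) ℂ} {α : ℂ}

/-- Reality in components: zeros at `α` of the `conj W` component become zeros at `conj α` of the
`W` component, and the `A` component is symmetric. -/
theorem mul_eq_conj (h : IsLoopNumerator l H) (U : Submodule ℂ C7) (z : ℂ) :
    projMatrix (conjSubspace U) * H z =
      (projMatrix U * H (starRingEnd ℂ z)).map (starRingEnd ℂ) := by
  rw [Matrix.map_mul, h.map_conj, projMatrix_map_conj]

theorem exists_of_factor (h : IsLoopNumerator (α :: l) H) {K : ℂ → Matrix (Fin 7) (Fin 7) ℂ}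
    (hK : ∀ i j, Differentiable ℂ fun z => K z i j)
    (hHK : ∀ z, H z = ((z - α) * (z - starRingEnd ℂ α)) • K z) :
    ∃ H', IsLoopNumerator l H' ∧ numeratorGerm l H' = numeratorGerm (α :: l) H := by
  have hval : ∀ z ∉ {z | conjPoleProd (α :: l) z = 0}, loopValue l K z =
      loopValue (α :: l) H z := by
    intro z hz
    simp only [Set.mem_ofPred_eq, conjPoleProd_cons, mul_eq_zero, not_or] at hz
    rw [loopValue, loopValue, hHK, smul_smul, conjPoleProd_cons]
    congr 1
    obtain ⟨⟨h1, h2⟩, h3⟩ := hz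
    field_simp
  refine ⟨K, ?_, numeratorGerm_congr (finite_conjPoleProd_eq_zero (α :: l)) hval⟩
  refine IsLoopNumerator.of_finite (F := loopValue (α :: l) H) hK
    (finite_conjPoleProd_eq_zero (α :: l)) ?_ (fun z hz => h.loopValue_dot hz)
    (fun z hz => h.loopValue_imMul hz) (fun z _ => h.loopValue_conj z) h.tendsto
  intro z hz
  rw [← hval z hz, loopValue, smul_smul, mul_inv_cancel₀, one_smul]
  simp only [Set.mem_ofPred_eq, conjPoleProd_cons, mul_eq_zero, not_or] at hz
  exact hz.2

theorem exists_of_eq_zero (h : IsLoopNumerator (α :: l) H) (hα : α.im ≠ 0) (hA : H α = 0) :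
    ∃ H', IsLoopNumerator l H' ∧ numeratorGerm l H' = numeratorGerm (α :: l) H := by
  have hα := sub_conj_ne_zero hα
  obtain ⟨K, hK, hHK, -⟩ := exists_eq_sub_smul h.differentiable hA
  have hK0 : K (starRingEnd ℂ α) = 0 := by
    have h1 := hHK (starRingEnd ℂ α)
    have h2 : H (starRingEnd ℂ α) = 0 := by
      rw [← h.map_conj, Complex.conj_conj, hA]
      ext i j
      simp
    rw [h2] at h1
    refine (smul_eq_zero.mp h1.symm).resolve_left fun h0 => hα ?_
    linear_combination -h0
  obtain ⟨K', hK', hKK', -⟩ := exists_eq_sub_smul hK hK0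
  exact h.exists_of_factor hK' fun z => by rw [hHK, hKK', smul_smul]

/-- A real isotropic matrix vanishes. -/
theorem _root_.eq_zero_of_real_of_dot {A : Matrix (Fin 7) (Fin 7) ℂ}
    (hr : A.map (starRingEnd ℂ) = A) (hdot : ∀ u v, (A *ᵥ u) ⬝ᵥ (A *ᵥ v) = 0) : A = 0 := by
  ext i j
  have h1 : star (A *ᵥ Pi.single j 1) = A *ᵥ Pi.single j 1 := by
    have h2 := map_conj_mulVec A (star (Pi.single j 1))
    rw [hr, star_star, ← Pi.single_star, star_one] at h2
    exact h2.symm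
  have h3 : A *ᵥ Pi.single j 1 = 0 := by
    by_contra h0
    apply star_dotProduct_self_ne_zero h0
    rw [h1, hdot]
  simpa using congrFun h3 i

theorem exists_of_im_eq_zero (h : IsLoopNumerator (α :: l) H) (hα : α.im = 0) :
    ∃ H', IsLoopNumerator l H' ∧ numeratorGerm l H' = numeratorGerm (α :: l) H := by
  have hc : starRingEnd ℂ α = α := Complex.conj_eq_iff_im.mpr hα
  have hA : H α = 0 := by
    refine eq_zero_of_real_of_dot (by simpa [hc] using h.map_conj α) fun u v => ?_
    rw [h.dot_eq]
    simp
  obtain ⟨K, hK, hHK, -⟩ := exists_eq_sub_smul h.differentiable hA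
  have hKc := continuous_of_differentiable_entries hK
  have hKu : ∀ u, Continuous fun z => K z *ᵥ u := fun u => hKc.matrix_mulVec continuous_const
  -- For real `α` the factor to cancel is `(z - α)²`. After one division `K` is still real on the
  -- real axis, and its form relation retains a factor `(z - α)²`, so `K α` vanishes by the same
  -- argument.
  have hK0 : K α = 0 := by
    refine eq_zero_of_real_of_dot ?_ fun u v => ?_
    · have h1 := congrFun (Continuous.ext_on (dense_compl_singleton α)
        (f := fun z => (K (starRingEnd ℂ z)).map (starRingEnd ℂ)) (g := K)
        ((hKc.comp Complex.continuous_conj).matrix_map Complex.continuous_conj) hKc (by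
          intro z hz
          have hz' : z - α ≠ 0 := sub_ne_zero.mpr hz
          have h2 := h.map_conj z
          rw [hHK, hHK z] at h2
          apply smul_right_injective _ hz'
          refine Eq.trans ?_ h2
          ext i j
          simp [hc])) α
      simpa [hc] using h1
    · have h1 := congrFun (Continuous.ext_on (dense_compl_singleton α)
        (f := fun z => (K z *ᵥ u) ⬝ᵥ (K z *ᵥ v))
        (g := fun z => (z - α) ^ 2 * conjPoleProd l z ^ 2 * (u ⬝ᵥ v))
        ((hKu u).dotProduct (hKu v))
        ((((continuous_id.sub continuous_const).pow 2).mul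
          ((differentiable_conjPoleProd l).continuous.pow 2)).mul continuous_const) (by
          intro z hz
          have hz' : z - α ≠ 0 := sub_ne_zero.mpr hz
          have h2 := h.dot_eq z u v
          rw [hHK, Matrix.smul_mulVec, Matrix.smul_mulVec, smul_dotProduct, dotProduct_smul,
            conjPoleProd_cons, hc, smul_eq_mul, smul_eq_mul] at h2
          apply mul_left_cancel₀ (pow_ne_zero 2 hz')
          linear_combination h2)) α
      simpa using h1
  obtain ⟨K', hK', hKK', -⟩ := exists_eq_sub_smul hK hK0
  exact h.exists_of_factor hK' fun z => by rw [hHK, hKK', smul_smul, hc]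

/-- The `conj W` component of `H` has a double zero at `α`, the `A` component simple zeros at `α`
and `conj α`, the `W` component a double zero at `conj α`. The factors of `p_{α,W}` turn each of
these into `(z - α)(z - conj α)`. -/
theorem exists_of_isReducing (h : IsLoopNumerator (α :: l) H) (hα : α.im ≠ 0) {W : Submodule ℂ C7}
    (hW : IsComplexCoassociative W) (hred : IsReducing W (H α) (matrixDeriv H α)) :
    ∃ H', IsLoopNumerator l H' ∧
      numeratorGerm l H' = simpleElement α W hW * numeratorGerm (α :: l) H := by
  have hα := sub_conj_ne_zero hα
  have hC0 : projMatrix (conjSubspace W) * H α = 0 := by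
    refine Matrix.ext_iff_mulVec.mpr fun v => ?_
    rw [← Matrix.mulVec_mulVec, Matrix.zero_mulVec]
    exact projMatrix_conj_mulVec fun w hw => hW.dotProduct_eq_zero hw (hred.1 v)
  have hA0 : projMatrix (assocComplement W) * H α = 0 := by
    refine Matrix.ext_iff_mulVec.mpr fun v => ?_
    rw [← Matrix.mulVec_mulVec, Matrix.zero_mulVec]
    exact projMatrix_assoc_mulVec (hred.1 v)
  have hC1 : projMatrix (conjSubspace W) * matrixDeriv H α = 0 := by
    refine Matrix.ext_iff_mulVec.mpr fun v => ?_
    rw [← Matrix.mulVec_mulVec, Matrix.zero_mulVec]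
    exact projMatrix_conj_mulVec fun w hw => hred.2 w hw v
  obtain ⟨K₁, hK₁, hCK₁, hK₁α⟩ := exists_eq_sub_smul
    (differentiable_mul_left (projMatrix (conjSubspace W)) h.differentiable) hC0
  rw [matrixDeriv_mul_left _ h.differentiable, hC1] at hK₁α
  obtain ⟨K, hK, hK₁K, -⟩ := exists_eq_sub_smul hK₁ hK₁α
  obtain ⟨L₁, hL₁, hAL₁, -⟩ := exists_eq_sub_smul
    (differentiable_mul_left (projMatrix (assocComplement W)) h.differentiable) hA0
  have hL₁α : L₁ (starRingEnd ℂ α) = 0 := by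
    have h1 := hAL₁ (starRingEnd ℂ α)
    have h2 := h.mul_eq_conj (assocComplement W) (starRingEnd ℂ α)
    rw [conjSubspace_assocComplement, Complex.conj_conj, hA0] at h2
    have h3 : projMatrix (assocComplement W) * H (starRingEnd ℂ α) = 0 := by
      rw [h2]
      ext i j
      simp
    rw [h3] at h1
    refine (smul_eq_zero.mp h1.symm).resolve_left fun h0 => hα ?_
    linear_combination -h0
  obtain ⟨L, hL, hL₁L, -⟩ := exists_eq_sub_smul hL₁ hL₁α
  have hM : ∀ z, projMatrix W * H z = ((z - starRingEnd ℂ α) * (z - starRingEnd ℂ α)) •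
      (K (starRingEnd ℂ z)).map (starRingEnd ℂ) := by
    intro z
    have h1 := h.mul_eq_conj (conjSubspace W) z
    rw [conjSubspace_conjSubspace, hCK₁, hK₁K] at h1
    rw [h1]
    ext i j
    simp
    ring
  have hdM := differentiable_conj_conj hK
  refine ⟨fun z => K z + L z + (K (starRingEnd ℂ z)).map (starRingEnd ℂ),
    h.simple_mul hW ?_ (finite_conjPoleProd_eq_zero (α :: l)) ?_⟩
  · intro i j
    exact ((hK i j).add (hL i j)).add (hdM i j)
  · intro z hz
    simp only [Set.mem_ofPred_eq, conjPoleProd_cons, mul_eq_zero, not_or] at hz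
    obtain ⟨⟨h1, h2⟩, h3⟩ := hz
    ext i j
    rw [loopValue, Matrix.mul_smul, Matrix.smul_apply, Matrix.smul_apply, simpleValue_mul_apply,
      hCK₁, hK₁K, hAL₁, hL₁L, hM]
    simp only [Matrix.add_apply, Matrix.smul_apply, smul_eq_mul, conjPoleProd_cons]
    field_simp

/-- The hypothesis makes the `conj W` component of `H` vanish at `α`, which absorbs the pole of
`p_{α,W}`; by reality the same happens at `conj α`. Hence the denominator does not grow. -/
theorem exists_rotate (h : IsLoopNumerator l H) (hα : α.im ≠ 0) {W : Submodule ℂ C7}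
    (hW : IsComplexCoassociative W)
    (hA : ∀ w, WithLp.toLp 2 w ∈ W → ∀ u, w ⬝ᵥ (H α *ᵥ u) = 0) :
    ∃ H', IsLoopNumerator l H' ∧
      numeratorGerm l H' = simpleElement α W hW * numeratorGerm l H ∧
      (∀ u, H' α *ᵥ u = (α - starRingEnd ℂ α) • projMatrix (conjSubspace W) *ᵥ
        (matrixDeriv H α *ᵥ u) + projMatrix (assocComplement W) *ᵥ (H α *ᵥ u)) ∧
      ∀ y, WithLp.toLp 2 (star y) ∈ W → (∀ u, y ⬝ᵥ (H α *ᵥ u) = 0) →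
        ∀ u, y ⬝ᵥ (matrixDeriv H' α *ᵥ u) = 0 := by
  have hα' := sub_conj_ne_zero hα
  have hC0 : projMatrix (conjSubspace W) * H α = 0 := by
    refine Matrix.ext_iff_mulVec.mpr fun v => ?_
    rw [← Matrix.mulVec_mulVec, Matrix.zero_mulVec]
    exact projMatrix_conj_mulVec fun w hw => hA w hw v
  obtain ⟨K, hK, hCK, hKα⟩ := exists_eq_sub_smul
    (differentiable_mul_left (projMatrix (conjSubspace W)) h.differentiable) hC0
  rw [matrixDeriv_mul_left _ h.differentiable] at hKα
  have hM : ∀ z, projMatrix W * H z = (z - starRingEnd ℂ α) •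
      (K (starRingEnd ℂ z)).map (starRingEnd ℂ) := by
    intro z
    have h1 := h.mul_eq_conj (conjSubspace W) z
    rw [conjSubspace_conjSubspace, hCK] at h1
    rw [h1]
    ext i j
    simp
  have hdM := differentiable_conj_conj hK
  set H' : ℂ → Matrix (Fin 7) (Fin 7) ℂ := fun z => (z - starRingEnd ℂ α) • K z
    + projMatrix (assocComplement W) * H z
    + (z - α) • (K (starRingEnd ℂ z)).map (starRingEnd ℂ) with hH'
  have hd' : ∀ i j, Differentiable ℂ fun z => H' z i j := by
    intro i j
    have h1 := differentiable_mul_left (projMatrix (assocComplement W)) h.differentiable i j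
    have h2 := hdM i j
    have h3 := hK i j
    exact ((((differentiable_id.sub_const _).mul h3)).add h1).add
      ((differentiable_id.sub_const _).mul h2)
  have hval : ∀ z ∉ ({α, starRingEnd ℂ α} : Set ℂ), H' z = simpleValue α W z * H z := by
    intro z hz
    simp only [Set.mem_insert_iff, Set.mem_singleton_iff, not_or] at hz
    have h1 := sub_ne_zero.mpr hz.1
    have h2 := sub_ne_zero.mpr hz.2
    ext i j
    rw [simpleValue_mul_apply, hCK, hM]
    simp only [hH', Matrix.add_apply, Matrix.smul_apply, smul_eq_mul]
    field_simp
  obtain ⟨hnum, hgerm⟩ := h.simple_mul hW (l' := l) hd'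
    ((finite_pair_conj α).union (finite_conjPoleProd_eq_zero l)) (fun z hz => by
      simp only [Set.mem_union, not_or] at hz
      rw [hval z hz.1, loopValue, Matrix.mul_smul, smul_smul, mul_inv_cancel₀ hz.2, one_smul])
  refine ⟨H', hnum, hgerm, ?_, ?_⟩
  · intro u
    simp only [hH', hKα, sub_self, zero_smul, add_zero, Matrix.add_mulVec, Matrix.smul_mulVec,
      Matrix.mulVec_mulVec]
  · intro y hy hyA u
    have hφ := (hasDerivAt_const α y).dotProduct_fun (hasDerivAt_mulVec hd' α u)
    have hψ := (hasDerivAt_const α y).dotProduct_fun (hasDerivAt_mulVec h.differentiable α u)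
    have hcont : ∀ {G : ℂ → Matrix (Fin 7) (Fin 7) ℂ},
        (∀ i j, Differentiable ℂ fun z => G z i j) → Continuous fun z => y ⬝ᵥ (G z *ᵥ u) :=
      fun hG => continuous_const.dotProduct
        ((continuous_of_differentiable_entries hG).matrix_mulVec continuous_const)
    -- Since `p_{α,W}` preserves the form and scales `y` by `(z - conj α)/(z - α)`, the pairing with
    -- `y` gains a zero at `α`. It already had one, so its derivative vanishes there too.
    have heq : (fun z => (z - starRingEnd ℂ α) * (y ⬝ᵥ (H' z *ᵥ u))) =
        fun z => (z - α) * (y ⬝ᵥ (H z *ᵥ u)) := by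
      refine Continuous.ext_on (dense_compl_of_finite (finite_pair_conj α))
        ((continuous_id.sub continuous_const).mul (hcont hd'))
        ((continuous_id.sub continuous_const).mul (hcont h.differentiable)) ?_
      intro z hz
      have hb := blaschke_ne_zero hz
      have h1 := hW.simpleMatrix_dotProduct hb
        (((z - α) / (z - starRingEnd ℂ α)) • y) (H z *ᵥ u)
      rw [Matrix.mulVec_smul, hW.simpleMatrix_mulVec_of_star_mem _ hy, smul_smul,
        mul_inv_cancel₀ hb, one_smul, smul_dotProduct, smul_eq_mul] at h1
      have h2 : z - starRingEnd ℂ α ≠ 0 := fun h0 => hb (by rw [h0, div_zero])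
      simp only
      rw [hval z hz, ← Matrix.mulVec_mulVec, simpleValue, h1]
      field_simp
    have h1 := ((hasDerivAt_id α).sub_const (starRingEnd ℂ α)).mul hφ
    have h2 : HasDerivAt (fun z => (z - α) * (y ⬝ᵥ (H z *ᵥ u))) _ α :=
      ((hasDerivAt_id α).sub_const α).mul hψ
    rw [← heq] at h2
    have h3 := h1.unique h2
    have h4 := congrFun heq α
    simp only [sub_self, zero_mul, mul_eq_zero, hα', false_or] at h4
    simpa [h4, hyA u, hα'] using h3

/-! ### Induction over the list of poles. -/

theorem exists_lower (h : IsLoopNumerator (α :: l) H) :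
    ∃ H', IsLoopNumerator l H' ∧ ∃ γ ∈ Subgroup.closure {γ : LoopGerm 7 | ∃ (α : ℂ)
      (W : Submodule ℂ C7) (hW : IsComplexCoassociative W), α.im ≠ 0 ∧ γ = simpleElement α W hW},
      numeratorGerm l H' = γ * numeratorGerm (α :: l) H := by
  by_cases hα : α.im = 0
  · obtain ⟨H', hH', hg⟩ := h.exists_of_im_eq_zero hα
    exact ⟨H', hH', 1, one_mem _, by rw [hg, one_mul]⟩
  have hQ : conjPoleProd (α :: l) α = 0 := by simp
  have hred : ∀ {H : ℂ → Matrix (Fin 7) (Fin 7) ℂ}, IsLoopNumerator (α :: l) H →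
      (H α = 0 ∨ ∃ W, IsComplexCoassociative W ∧ IsReducing W (H α) (matrixDeriv H α)) →
      ∃ H', IsLoopNumerator l H' ∧ ∃ γ ∈ Subgroup.closure {γ : LoopGerm 7 | ∃ (α : ℂ)
        (W : Submodule ℂ C7) (hW : IsComplexCoassociative W), α.im ≠ 0 ∧ γ = simpleElement α W hW},
        numeratorGerm l H' = γ * numeratorGerm (α :: l) H := by
    rintro H h (hA | ⟨W, hW, hr⟩)
    · obtain ⟨H', hH', hg⟩ := h.exists_of_eq_zero hα hA
      exact ⟨H', hH', 1, one_mem _, by rw [hg, one_mul]⟩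
    · obtain ⟨H', hH', hg⟩ := h.exists_of_isReducing hα hW hr
      exact ⟨H', hH', _, Subgroup.subset_closure ⟨α, W, hW, hα, rfl⟩, hg⟩
  by_cases hA : H α = 0
  · exact hred h (Or.inl hA)
  obtain hW | ⟨e, f, he, hli, horth⟩ := (h.isPolePair hQ).exists_isReducing_or hA
  · exact hred h (Or.inr hW)
  obtain ⟨W, hW, hWA, y, z, hy0, hyW, hyA, hspan⟩ :=
    (h.isPolePair hQ).exists_rotating he hli horth (α - starRingEnd ℂ α)
  obtain ⟨H₁, hH₁, hg₁, hval, hder⟩ := h.exists_rotate hα hW hWA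
  have hor : H₁ α = 0 ∨
      ∃ W, IsComplexCoassociative W ∧ IsReducing W (H₁ α) (matrixDeriv H₁ α) := by
    by_cases hA₁ : H₁ α = 0
    · exact Or.inl hA₁
    · exact Or.inr ((hH₁.isPolePair hQ).exists_isReducing_of_mem_span hA₁ hy0 (hder y hyW hyA)
        fun u => by rw [hval]; exact hspan u)
  obtain ⟨H₂, hH₂, γ, hγ, hg₂⟩ := hred hH₁ hor
  exact ⟨H₂, hH₂, γ * simpleElement α W hW, mul_mem hγ
    (Subgroup.subset_closure ⟨α, W, hW, hα, rfl⟩), by rw [hg₂, hg₁, mul_assoc]⟩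

theorem eq_one (h : IsLoopNumerator [] H) (z : ℂ) : H z = 1 := by
  have hlim : Tendsto H (cocompact ℂ) (𝓝 1) := by simpa using h.tendsto
  ext i j
  refine (h.differentiable i j).apply_eq_of_tendsto_cocompact z ?_
  exact ((continuous_apply_apply i j).tendsto _).comp hlim

theorem numeratorGerm_mem_closure : ∀ {l : List ℂ} {H : ℂ → Matrix (Fin 7) (Fin 7) ℂ},
    IsLoopNumerator l H → numeratorGerm l H ∈ Subgroup.closure {γ : LoopGerm 7 | ∃ (α : ℂ)
      (W : Submodule ℂ C7) (hW : IsComplexCoassociative W), α.im ≠ 0 ∧ γ = simpleElement α W hW}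
  | [], H, h => by
    have h1 : numeratorGerm [] H = 1 := by
      rw [numeratorGerm, ← Germ.coe_one, Germ.coe_eq]
      refine eventually_denseOpen_of_finite Set.finite_empty fun z _ => Units.ext ?_
      rw [extendToGL_coe, loopValue, h.eq_one, conjPoleProd_nil, inv_one, one_smul,
        coe_matrixToGL isUnit_one]
      rfl
    rw [h1]
    exact one_mem _
  | α :: l, H, h => by
    obtain ⟨H', hH', γ, hγ, hg⟩ := h.exists_lower
    have := numeratorGerm_mem_closure hH'
    rwa [hg, Subgroup.mul_mem_cancel_left _ hγ] at this

end IsLoopNumerator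

/-! ### Simple elements belong to the loop group -/

section

variable {α : ℂ} {W : Submodule ℂ C7} (hW : IsComplexCoassociative W)

open Classical in
/-- The representative of the simple element used in its definition. -/
noncomputable def simpleMap (α : ℂ) (hW : IsComplexCoassociative W) (p : OnePoint ℂ) :
    GL (Fin 7) ℂ :=
  if h : blaschke α p ≠ 0 then simpleGL W hW (blaschke α p) h else 1

theorem coe_simpleMap {p : OnePoint ℂ} (hp : blaschke α p ≠ 0) :
    (simpleMap α hW p : Matrix (Fin 7) (Fin 7) ℂ) = simpleMatrix W (blaschke α p) := by
  rw [simpleMap, dif_pos hp]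
  rfl

theorem simpleMap_mem (p : OnePoint ℂ) : simpleMap α hW p ∈ complexG2 := by
  rw [simpleMap]
  split_ifs with hp
  · exact simpleGL_mem_complexG2 hW hp
  · exact one_mem _

theorem analyticAt_simpleMatrix (W : Submodule ℂ C7) {r : ℂ → ℂ} {a : ℂ} (hr : AnalyticAt ℂ r a)
    (ha : r a ≠ 0) (i j : Fin 7) : AnalyticAt ℂ (fun w => simpleMatrix W (r w) i j) a := by
  simp only [simpleMatrix, Matrix.add_apply, Matrix.smul_apply, smul_eq_mul]
  exact (((hr.inv ha).mul analyticAt_const).add analyticAt_const).add (hr.mul analyticAt_const)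

theorem meromorphicAt_simpleMatrix (W : Submodule ℂ C7) {r : ℂ → ℂ} {a : ℂ}
    (hr : MeromorphicAt r a) (i j : Fin 7) :
    MeromorphicAt (fun w => simpleMatrix W (r w) i j) a := by
  simp only [simpleMatrix, Matrix.add_apply, Matrix.smul_apply, smul_eq_mul]
  exact ((hr.inv.mul (MeromorphicAt.const _ _)).add (MeromorphicAt.const _ _)).add
    (hr.mul (MeromorphicAt.const _ _))

theorem blaschke_cpCoord_infty (α w : ℂ) : blaschke α (cpCoord ∞ w) =
    (1 - α * w) / (1 - starRingEnd ℂ α * w) := by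
  by_cases hw : w = 0
  · simp [cpCoord, hw, blaschke]
  · have h1 : cpCoord ∞ w = ((w⁻¹ : ℂ) : OnePoint ℂ) := by simp [cpCoord, hw]
    rw [h1, blaschke_coe, ← mul_div_mul_right _ _ hw, sub_mul, sub_mul, inv_mul_cancel₀ hw]

theorem holomorphicAtPt_simpleMap_infty (α : ℂ) :
    HolomorphicAtPt (fun q => (simpleMap α hW q : Matrix (Fin 7) (Fin 7) ℂ)) ∞ := by
  intro i j
  have h1 : AnalyticAt ℂ (fun w : ℂ => (1 - α * w) / (1 - starRingEnd ℂ α * w)) 0 := by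
    refine AnalyticAt.div ?_ ?_ (by simp)
    · exact analyticAt_const.sub (analyticAt_const.mul analyticAt_id)
    · exact analyticAt_const.sub (analyticAt_const.mul analyticAt_id)
  refine (analyticAt_simpleMatrix W h1 (by simp) i j).congr ?_
  have h2 : ∀ᶠ w in 𝓝 (0 : ℂ), (1 - α * w) / (1 - starRingEnd ℂ α * w) ≠ 0 :=
    h1.continuousAt.eventually_ne (by simp)
  filter_upwards [h2] with w hw
  rw [← blaschke_cpCoord_infty] at hw ⊢
  rw [coe_simpleMap hW hw]

theorem holomorphicAtPt_simpleMap_coe {z : ℂ} (hz : z ∉ ({α, starRingEnd ℂ α} : Set ℂ)) :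
    HolomorphicAtPt (fun q => (simpleMap α hW q : Matrix (Fin 7) (Fin 7) ℂ)) (z : OnePoint ℂ) := by
  intro i j
  have hz' : z - starRingEnd ℂ α ≠ 0 := by
    simp only [Set.mem_insert_iff, Set.mem_singleton_iff, not_or] at hz
    exact sub_ne_zero.mpr hz.2
  have h1 : AnalyticAt ℂ (fun w : ℂ => (w - α) / (w - starRingEnd ℂ α)) z :=
    (analyticAt_id.sub analyticAt_const).div (analyticAt_id.sub analyticAt_const) hz'
  refine (analyticAt_simpleMatrix W h1 (blaschke_ne_zero hz) i j).congr ?_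
  filter_upwards [h1.continuousAt.eventually_ne (blaschke_ne_zero hz)] with w hw
  rw [← blaschke_coe] at hw ⊢
  change _ = (simpleMap α hW (w : OnePoint ℂ) : Matrix (Fin 7) (Fin 7) ℂ) i j
  rw [coe_simpleMap hW hw]

theorem meromorphicAtPt_simpleMap (α : ℂ) (p : OnePoint ℂ) :
    MeromorphicAtPt (fun q => (simpleMap α hW q : Matrix (Fin 7) (Fin 7) ℂ)) p := by
  intro i j
  induction p using OnePoint.rec with
  | infty => exact (holomorphicAtPt_simpleMap_infty hW α i j).meromorphicAt
  | coe z =>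
    have h1 : MeromorphicAt (fun w : ℂ => (w - α) / (w - starRingEnd ℂ α)) z :=
      (analyticAt_id.sub analyticAt_const).meromorphicAt.div
        (analyticAt_id.sub analyticAt_const).meromorphicAt
    refine (meromorphicAt_simpleMatrix W h1 i j).congr ?_
    have h2 : ∀ᶠ w in 𝓝[≠] z, w ∉ ({α, starRingEnd ℂ α} : Set ℂ) := by
      have h3 : (({α, starRingEnd ℂ α} : Set ℂ) \ {z})ᶜ ∈ 𝓝 z :=
        ((finite_pair_conj α).sdiff).isClosed.isOpen_compl.mem_nhds (by simp)
      filter_upwards [nhdsWithin_le_nhds h3, self_mem_nhdsWithin] with w hw1 hw2 hw3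
      exact hw1 ⟨hw3, hw2⟩
    filter_upwards [h2] with w hw
    have hb := blaschke_ne_zero hw
    rw [← blaschke_coe] at hb ⊢
    change _ = (simpleMap α hW (w : OnePoint ℂ) : Matrix (Fin 7) (Fin 7) ℂ) i j
    rw [coe_simpleMap hW hb]

theorem simpleElement_mem (α : ℂ) :
    simpleElement α W hW ∈ negRationalRealLoops complexG2 := by
  have hrep : simpleElement α W hW = ((simpleMap α hW : OnePoint ℂ → GL (Fin 7) ℂ) : LoopGerm 7) :=
    rfl
  refine ⟨⟨⟨⟨simpleMap α hW, hrep, ?_⟩, ⟨_, rfl, meromorphicAtPt_simpleMap hW α⟩⟩,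
    ⟨simpleMap α hW, hrep, holomorphicAtPt_simpleMap_infty hW α, ?_⟩⟩,
    ⟨simpleMap α hW, hrep, ?_⟩⟩
  · refine ⟨(fun z : ℂ => (z : OnePoint ℂ)) '' {α, starRingEnd ℂ α}ᶜ,
      OnePoint.isOpenEmbedding_coe.isOpenMap _ (finite_pair_conj α).isClosed.isOpen_compl,
      OnePoint.denseRange_coe.dense_image OnePoint.continuous_coe
        (dense_compl_of_finite (finite_pair_conj α)), ?_⟩
    rintro _ ⟨z, hz, rfl⟩
    exact ⟨simpleMap_mem hW _, holomorphicAtPt_simpleMap_coe hW hz⟩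
  · have hb : blaschke α ∞ = 1 := rfl
    apply Units.ext
    rw [coe_simpleMap hW (by rw [hb]; exact one_ne_zero), hb, simpleMatrix_one hW]
    rfl
  · refine eventually_denseOpen_of_finite (finite_pair_conj α) fun z hz => ?_
    have hz' : starRingEnd ℂ z ∉ ({α, starRingEnd ℂ α} : Set ℂ) := by
      intro h
      apply hz
      rcases h with h | h
      · right
        rw [Set.mem_singleton_iff, ← h, Complex.conj_conj]
      · left
        exact (starRingEnd ℂ).injective h
    apply Units.ext
    rw [OnePoint.map_some]
    have h1 := coe_simpleMap hW (α := α) (p := (z : OnePoint ℂ)) (blaschke_ne_zero hz)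
    have h2 := coe_simpleMap hW (α := α) (p := (starRingEnd ℂ z : ℂ)) (blaschke_ne_zero hz')
    have h3 := simpleValue_map_conj α W z
    rw [h1]
    refine Eq.trans ?_ h3
    change (simpleMap α hW ((starRingEnd ℂ z : ℂ) : OnePoint ℂ)).1.map (starRingEnd ℂ) = _
    rw [h2]
    rfl

end

/-! ### Rational loops have numerators -/

theorem conjPoleProd_append (l l' : List ℂ) (z : ℂ) :
    conjPoleProd (l ++ l') z = conjPoleProd l z * conjPoleProd l' z := by
  simp [conjPoleProd]

theorem conjPoleProd_replicate (n : ℕ) (a z : ℂ) :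
    conjPoleProd (List.replicate n a) z = ((z - a) * (z - starRingEnd ℂ a)) ^ n := by
  simp [conjPoleProd]

theorem analyticAt_conjPoleProd (l : List ℂ) (z : ℂ) : AnalyticAt ℂ (conjPoleProd l) z :=
  (differentiable_conjPoleProd l).analyticAt z

section

variable {N : ℂ → Matrix (Fin 7) (Fin 7) ℂ}

theorem order_nonneg_of_analyticAt (l : List ℂ) {z : ℂ} {i j : Fin 7}
    (h : AnalyticAt ℂ (fun w => N w i j) z) :
    0 ≤ meromorphicOrderAt (fun w => conjPoleProd l w * N w i j) z :=
  ((analyticAt_conjPoleProd l z).mul h).meromorphicOrderAt_nonneg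

theorem order_nonneg_append (hN : ∀ z i j, MeromorphicAt (fun w => N w i j) z) (l l' : List ℂ)
    {z : ℂ} {i j : Fin 7} (h : 0 ≤ meromorphicOrderAt (fun w => conjPoleProd l w * N w i j) z) :
    0 ≤ meromorphicOrderAt (fun w => conjPoleProd (l' ++ l) w * N w i j) z := by
  simp only [conjPoleProd_append, mul_assoc]
  have h1 := (analyticAt_conjPoleProd l' z)
  have h2 := (analyticAt_conjPoleProd l z).meromorphicAt.mul (hN z i j)
  have h3 := meromorphicOrderAt_mul h1.meromorphicAt h2
  refine le_trans ?_ h3.ge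
  exact add_nonneg h1.meromorphicOrderAt_nonneg h

theorem exists_replicate_order_nonneg (hN : ∀ z i j, MeromorphicAt (fun w => N w i j) z) (x : ℂ) :
    ∃ l, ∀ᶠ z in 𝓝 x, ∀ i j,
      0 ≤ meromorphicOrderAt (fun w => conjPoleProd l w * N w i j) z := by
  have h1 : ∀ ij : Fin 7 × Fin 7, ∃ n : ℕ,
      AnalyticAt ℂ (fun z => (z - x) ^ n • N z ij.1 ij.2) x := fun ij => hN x ij.1 ij.2
  choose n hn using h1
  -- Any common bound for the pole orders of the 49 entries would do. The extra zeros at `conj x`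
  -- are harmless.
  set m := ∑ ij, n ij with hm
  refine ⟨List.replicate m x, ?_⟩
  have h2 : ∀ i j, 0 ≤ meromorphicOrderAt
      (fun w => conjPoleProd (List.replicate m x) w * N w i j) x := by
    intro i j
    have hle : n (i, j) ≤ m := Finset.single_le_sum (f := n) (fun _ _ => Nat.zero_le _)
      (Finset.mem_univ (i, j))
    have h3 : AnalyticAt ℂ (fun z => ((z - x) ^ (m - n (i, j)) * (z - starRingEnd ℂ x) ^ m) *
        ((z - x) ^ n (i, j) • N z i j)) x := by
      refine AnalyticAt.mul (AnalyticAt.mul ?_ ?_) (hn (i, j))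
      · exact (analyticAt_id.sub analyticAt_const).pow _
      · exact (analyticAt_id.sub analyticAt_const).pow _
    refine (h3.congr (Eventually.of_forall fun z => ?_)).meromorphicOrderAt_nonneg
    simp only [conjPoleProd_replicate, smul_eq_mul, mul_pow]
    rw [← pow_sub_mul_pow (z - x) hle]
    ring
  have h4 : ∀ᶠ z in 𝓝[≠] x, ∀ i j, AnalyticAt ℂ (fun w => N w i j) z :=
    eventually_all.mpr fun i => eventually_all.mpr fun j => (hN x i j).eventually_analyticAt
  rw [← nhdsNE_sup_pure, eventually_sup]
  refine ⟨?_, by simpa using h2⟩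
  filter_upwards [h4] with z hz i j
  exact order_nonneg_of_analyticAt _ (hz i j)

/-- Local denominators exist near each point, none is needed near `∞`, and compactness of the rest
leaves finitely many to concatenate. -/
theorem exists_order_nonneg (hN : ∀ z i j, MeromorphicAt (fun w => N w i j) z)
    (hinf : ∀ᶠ z in cocompact ℂ, ∀ i j, AnalyticAt ℂ (fun w => N w i j) z) :
    ∃ l, ∀ z i j, 0 ≤ meromorphicOrderAt (fun w => conjPoleProd l w * N w i j) z := by
  obtain ⟨K, hK, hKN⟩ := mem_cocompact.mp hinf
  have h : ∃ l, ∀ z ∈ K, ∀ i j,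
      0 ≤ meromorphicOrderAt (fun w => conjPoleProd l w * N w i j) z := by
    refine hK.induction_on (p := fun s => ∃ l, ∀ z ∈ s, ∀ i j,
      0 ≤ meromorphicOrderAt (fun w => conjPoleProd l w * N w i j) z) ⟨[], by simp⟩ ?_ ?_ ?_
    · rintro s t hst ⟨l, hl⟩
      exact ⟨l, fun z hz => hl z (hst hz)⟩
    · rintro s t ⟨l, hl⟩ ⟨l', hl'⟩
      refine ⟨l ++ l', fun z hz i j => ?_⟩
      rcases hz with hz | hz
      · have h1 := order_nonneg_append hN l l' (hl z hz i j)
        simpa only [conjPoleProd_append, mul_comm (conjPoleProd l' _)] using h1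
      · exact order_nonneg_append hN l' l (hl' z hz i j)
    · intro x _
      obtain ⟨l, hl⟩ := exists_replicate_order_nonneg hN x
      exact ⟨_, nhdsWithin_le_nhds hl, l, fun z hz => hz⟩
  obtain ⟨l, hl⟩ := h
  refine ⟨l, fun z i j => ?_⟩
  by_cases hz : z ∈ K
  · exact hl z hz i j
  · exact order_nonneg_of_analyticAt l (hKN hz i j)

/-- A meromorphic function in normal form with nonnegative order is analytic. Normalising may change
isolated values, hence the punctured neighbourhoods. -/
theorem exists_entire (hN : ∀ z i j, MeromorphicAt (fun w => N w i j) z) {l : List ℂ}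
    (hl : ∀ z i j, 0 ≤ meromorphicOrderAt (fun w => conjPoleProd l w * N w i j) z) :
    ∃ H : ℂ → Matrix (Fin 7) (Fin 7) ℂ, (∀ i j, Differentiable ℂ fun z => H z i j) ∧
      ∀ x, ∀ᶠ z in 𝓝[≠] x, H z = conjPoleProd l z • N z := by
  have hm : ∀ i j, MeromorphicOn (fun w => conjPoleProd l w * N w i j) Set.univ := fun i j z _ =>
    (analyticAt_conjPoleProd l z).meromorphicAt.mul (hN z i j)
  refine ⟨fun z => Matrix.of fun i j =>
    toMeromorphicNFOn (fun w => conjPoleProd l w * N w i j) Set.univ z, ?_, ?_⟩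
  · intro i j z
    have h1 := meromorphicNFOn_toMeromorphicNFOn
      (fun w => conjPoleProd l w * N w i j) Set.univ (Set.mem_univ z)
    refine (h1.meromorphicOrderAt_nonneg_iff_analyticAt.mp ?_).differentiableAt
    rw [meromorphicOrderAt_toMeromorphicNFOn (hm i j) (Set.mem_univ z)]
    exact hl z i j
  · intro x
    have h1 : ∀ᶠ z in 𝓝[≠] x, ∀ i j, toMeromorphicNFOn (fun w => conjPoleProd l w * N w i j)
        Set.univ z = conjPoleProd l z * N z i j :=
      eventually_all.mpr fun i => eventually_all.mpr fun j =>
        (hm i j).toMeromorphicNFOn_eq_self_on_nhdsNE (Set.mem_univ x)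
    filter_upwards [h1] with z hz
    ext i j
    exact hz i j

end

/-! ### Dense open sets and behaviour at infinity. -/

theorem exists_dense_of_eventually {P : ℂ → Prop} (h : ∀ x, ∀ᶠ z in 𝓝[≠] x, P z) :
    ∃ T : Set ℂ, IsOpen T ∧ Dense T ∧ ∀ z ∈ T, P z := by
  refine ⟨interior {z | P z}, isOpen_interior, fun x => ?_, fun z hz => interior_subset hz⟩
  rw [mem_closure_iff_frequently]
  have h1 : ∀ᶠ z in 𝓝[≠] x, z ∈ interior {z | P z} := by
    have h2 := eventually_eventually_nhdsWithin.mpr (h x)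
    filter_upwards [h2, self_mem_nhdsWithin] with z hz hzx
    rw [mem_interior_iff_mem_nhds]
    rwa [IsOpen.nhdsWithin_eq isOpen_compl_singleton hzx] at hz
  exact h1.frequently.filter_mono nhdsWithin_le_nhds

theorem exists_dense_of_eventually_denseOpen {P : OnePoint ℂ → Prop}
    (h : ∀ᶠ p in denseOpen (OnePoint ℂ), P p) :
    ∃ T : Set ℂ, IsOpen T ∧ Dense T ∧ ∀ z ∈ T, P (z : OnePoint ℂ) := by
  obtain ⟨U, hU, hUd, hUP⟩ := h
  exact ⟨(fun z : ℂ => (z : OnePoint ℂ)) ⁻¹' U, hU.preimage OnePoint.continuous_coe,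
    hUd.preimage OnePoint.isOpenEmbedding_coe.isOpenMap, fun z hz => hUP hz⟩

theorem cpCoord_infty_inv {z : ℂ} (hz : z ≠ 0) : cpCoord ∞ z⁻¹ = (z : OnePoint ℂ) := by
  simp [cpCoord, hz]

theorem frequently_cocompact_of_dense {T : Set ℂ} (hT : Dense T) :
    ∃ᶠ z in cocompact ℂ, z ∈ T := by
  intro h
  obtain ⟨K, hK, hKT⟩ := mem_cocompact.mp h
  have hne : Kᶜ.Nonempty := Set.nonempty_compl.mpr fun h0 => by
    rw [h0] at hK
    exact noncompact_univ ℂ hK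
  obtain ⟨z, hz1, hz2⟩ := hT.inter_open_nonempty _ hK.isClosed.isOpen_compl hne
  exact hKT hz1 hz2

theorem tendsto_inv_cocompact : Tendsto (fun z : ℂ => z⁻¹) (cocompact ℂ) (𝓝[≠] 0) := by
  rw [← Metric.cobounded_eq_cocompact]
  exact tendsto_inv₀_cobounded'

/-- A meromorphic map that agrees on an open dense set with a map that is holomorphic at `∞` is
analytic near `∞` and has the same limit there. -/
theorem analyticAt_and_tendsto_of_holomorphicAtPt_infty
    {M f : OnePoint ℂ → Matrix (Fin 7) (Fin 7) ℂ} (hM : MeromorphicAtPt M ∞)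
    (hf : HolomorphicAtPt f ∞) {T : Set ℂ} (hT : Dense T)
    (hMf : ∀ z ∈ T, M (z : OnePoint ℂ) = f z) :
    (∀ᶠ z in cocompact ℂ, ∀ i j, AnalyticAt ℂ (fun w : ℂ => M (w : OnePoint ℂ) i j) z) ∧
      Tendsto (fun z : ℂ => M (z : OnePoint ℂ)) (cocompact ℂ) (𝓝 (f ∞)) := by
  have h0 : ∀ᶠ z : ℂ in cocompact ℂ, z ≠ 0 :=
    eventually_cocompact_notMem (Set.finite_singleton 0)
  constructor
  · have h1 : ∀ᶠ w in 𝓝[≠] (0 : ℂ), ∀ i j, AnalyticAt ℂ (fun w => M (cpCoord ∞ w) i j) w :=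
      eventually_all.mpr fun i => eventually_all.mpr fun j => (hM i j).eventually_analyticAt
    filter_upwards [tendsto_inv_cocompact.eventually h1, h0] with z hz hz0 i j
    have h2 : AnalyticAt ℂ (fun w : ℂ => w⁻¹) z := analyticAt_id.inv hz0
    refine ((hz i j).comp_of_eq h2 rfl).congr ?_
    filter_upwards [eventually_ne_nhds hz0] with w hw
    simp only [Function.comp_apply, cpCoord_infty_inv hw]
  · refine tendsto_pi_nhds.mpr fun i => tendsto_pi_nhds.mpr fun j => ?_
    -- A dense set accumulates at `∞`, and two functions meromorphic at a point that agree
    -- frequently near it agree on a punctured neighbourhood.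
    have h1 : ∃ᶠ w in 𝓝[≠] (0 : ℂ), M (cpCoord ∞ w) i j = f (cpCoord ∞ w) i j := by
      refine tendsto_inv_cocompact.frequently ?_
      refine ((frequently_cocompact_of_dense hT).and_eventually h0).mono ?_
      rintro z ⟨hz, hz0⟩
      rw [cpCoord_infty_inv hz0, hMf z hz]
    have h2 := ((hM i j).frequently_eq_iff_eventuallyEq (hf i j).meromorphicAt).mp h1
    have h3 : Tendsto (fun w => f (cpCoord ∞ w) i j) (𝓝[≠] 0) (𝓝 (f ∞ i j)) := by
      have h4 := (hf i j).continuousAt.tendsto.mono_left (nhdsWithin_le_nhds (s := {0}ᶜ))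
      have h5 : cpCoord ∞ (cpCenter ∞) = ∞ := by simp [cpCoord, cpCenter]
      rw [h5] at h4
      exact h4
    refine ((h3.congr' h2.symm).comp tendsto_inv_cocompact).congr' ?_
    filter_upwards [h0] with z hz0
    simp only [Function.comp_apply, cpCoord_infty_inv hz0]

theorem exists_isLoopNumerator {γ : LoopGerm 7} (hγ : γ ∈ negRationalRealLoops complexG2) :
    ∃ l H, IsLoopNumerator l H ∧ numeratorGerm l H = γ := by
  obtain ⟨⟨⟨⟨f, rfl, U, hU, hUd, hf⟩, ⟨M, hfM, hM⟩⟩, ⟨f₂, hf₂, hhol, hone⟩⟩, ⟨f₃, hf₃, hreal⟩⟩ := hγ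
  rw [Germ.map_coe, Germ.coe_eq] at hfM
  rw [Germ.coe_eq] at hf₂ hf₃
  have hfU : ∀ᶠ p in denseOpen (OnePoint ℂ), f p ∈ complexG2 := ⟨U, hU, hUd, fun p hp => (hf p hp).1⟩
  -- Each defining condition comes with its own representative of the germ; all of them are compared
  -- on one dense open set.
  obtain ⟨V, hVo, hVd, hV⟩ := exists_dense_of_eventually_denseOpen
    (hfM.and (hf₂.and (hf₃.and (hreal.and hfU))))
  set N : ℂ → Matrix (Fin 7) (Fin 7) ℂ := fun z => M (z : OnePoint ℂ) with hNdef
  have hfN : ∀ z ∈ V, (f (z : OnePoint ℂ) : Matrix (Fin 7) (Fin 7) ℂ) = N z := fun z hz => (hV z hz).1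
  have hNmer : ∀ z i j, MeromorphicAt (fun w => N w i j) z := fun z i j => hM (z : OnePoint ℂ) i j
  obtain ⟨hNinf, hNlim⟩ := analyticAt_and_tendsto_of_holomorphicAtPt_infty (hM ∞) hhol hVd
    (fun z hz => by rw [← (hV z hz).2.1]; exact (hfN z hz).symm)
  rw [hone, Units.val_one] at hNlim
  obtain ⟨l, hl⟩ := exists_order_nonneg hNmer hNinf
  obtain ⟨H, hHd, hHN⟩ := exists_entire hNmer hl
  have hHc := continuous_of_differentiable_entries hHd
  obtain ⟨T, hTo, hTd, hT⟩ := exists_dense_of_eventually hHN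
  have hHlim : Tendsto (fun z => (conjPoleProd l z)⁻¹ • H z) (cocompact ℂ) (𝓝 1) := by
    refine hNlim.congr' ?_
    filter_upwards [hNinf, eventually_cocompact_notMem (finite_conjPoleProd_eq_zero l)] with z hz hz0
    have h1 : ContinuousAt N z := continuousAt_pi.mpr fun i => continuousAt_pi.mpr fun j =>
      (hz i j).continuousAt
    have h2 : ContinuousAt (fun w => conjPoleProd l w • N w) z :=
      (analyticAt_conjPoleProd l z).continuousAt.smul h1
    -- Near `∞` the map `N` is analytic, so the equality on a punctured neighbourhood also holds at
    -- its centre.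
    have h3 : H z = conjPoleProd l z • N z :=
      tendsto_nhds_unique_of_eventuallyEq (hHc.continuousAt.mono_left nhdsWithin_le_nhds)
        (h2.mono_left nhdsWithin_le_nhds) (hHN z)
    rw [h3, smul_smul, inv_mul_cancel₀ hz0, one_smul]
  have hV'd : Dense (V ∩ starRingEnd ℂ ⁻¹' V) :=
    hVd.inter_of_isOpen_left (dense_preimage_conj hVd) hVo
  have hV'o : IsOpen (V ∩ starRingEnd ℂ ⁻¹' V) := hVo.inter (hVo.preimage Complex.continuous_conj)
  have hWd := hV'd.inter_of_isOpen_left hTd hV'o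
  have hWo := hV'o.inter hTo
  have hG : ∀ z ∈ V, (∀ u v, (N z *ᵥ u) ⬝ᵥ (N z *ᵥ v) = u ⬝ᵥ v) ∧
      ∀ u v, N z *ᵥ imMul u v = imMul (N z *ᵥ u) (N z *ᵥ v) := fun z hz => by
    rw [← hfN z hz]
    exact mem_complexG2_iff.mp (hV z hz).2.2.2.2
  refine ⟨l, H, IsLoopNumerator.of_dense (F := N) hHd hWo hWd ?_ ?_ ?_ ?_ hHlim, ?_⟩
  · exact fun z hz => hT z hz.2
  · exact fun z hz => (hG z hz.1.1).1
  · exact fun z hz => (hG z hz.1.1).2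
  · intro z hz
    have h1 := (hV z hz.1.1).2.2.2.1
    rw [OnePoint.map_some, ← (hV z hz.1.1).2.2.1, ← (hV _ hz.1.2).2.2.1] at h1
    have h2 := congrArg Units.val h1
    rw [hfN z hz.1.1] at h2
    rw [← h2, ← hfN _ hz.1.2]
    rfl
  · rw [numeratorGerm, Germ.coe_eq]
    have hQd := dense_compl_of_finite (finite_conjPoleProd_eq_zero l)
    have hQo := (finite_conjPoleProd_eq_zero l).isClosed.isOpen_compl
    refine eventually_denseOpen_of_dense (hWo.inter hQo) (hWd.inter_of_isOpen_left hQd hWo) ?_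
    intro z hz
    have h1 : loopValue l H z = f (z : OnePoint ℂ) := by
      rw [loopValue, hT z hz.1.2, smul_smul, inv_mul_cancel₀ hz.2, one_smul, hfN z hz.1.1.1]
    apply Units.ext
    rw [extendToGL_coe, h1, coe_matrixToGL (f (z : OnePoint ℂ)).isUnit]

/-- The simple elements `p_{α,W}`, for `α ∈ ℂ ∖ ℝ` and `W` a complex coassociative plane, generate
the negative rational real loop group of the complex group `G₂` on `ℂ⁷`. -/
theorem mainTheorem3 :
    Subgroup.closure {γ : LoopGerm 7 | ∃ (α : ℂ) (W : Submodule ℂ C7)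
        (hW : IsComplexCoassociative W), α.im ≠ 0 ∧ γ = simpleElement α W hW}
      = negRationalRealLoops complexG2 := by
  apply le_antisymm
  · rw [Subgroup.closure_le]
    rintro _ ⟨α, W, hW, -, rfl⟩
    exact simpleElement_mem hW α
  · intro γ hγ
    obtain ⟨l, H, h, rfl⟩ := exists_isLoopNumerator hγ
    exact h.numeratorGerm_mem_closure
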